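/- Let $K$ be a field, $R=K[X_1,\dots,X_n]$ with the standard $\mathbb Z^n$-grading, and let $M$ be a finitely generated $\mathbb Z^n$-graded $R$-module with $\dim_K M_a\le 1$ for all $a\in\mathbb Z^n$. A Stanley decomposition of $M$ is a finite decomposition $M=\bigoplus_i m_iK[Z_i]$ as a $K$-vector space with $m_i\in M$ homogeneous, $Z_i\subseteq\{X_1,\dots,X_n\}$ and $K[Z_i]\cap\operatorname{Ann} m_i=0$; $\operatorname{sdepth} M$ is the largest $s$ for which there is such a decomposition with $|Z_i|\ge s$ for all $i$ (and $\infty$ if $M=0$). For $g\in\mathbb N^n$, $M$ is called positively $g$-determined if $M_a=0$ for $a\notin\mathbb N^n$ and multiplication by $X_i$ is an isomorphism $M_a\to M_{a+e_i}$ whenever $a_i\ge g_i$. After a shift of the degrees (which does not change the Stanley depth) $M$ is positively $g$-determined for some $g$; fix any such shift and $g$. For $0\preceq a\preceq b\preceq g$ (componentwise order) put $Z_a=\{X_j: a_j=g_j\}$, $\rho(a)=|Z_a|$, $Q[a,b]=\sum_{a\preceq c\preceq b}X^c$ and $\mathcal G[a,b]=\{c\in[a,b]: c_j=a_j\text{ whenever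 }X_j\in Z_b\}$. For $s\in\mathbb N$ and $P\in\mathbb Z[X_1,\dots,X_n]$ with set of exponents $B$, the recursive procedure $\mathrm{CheckStanleyDepth}(g,s,P)$ is as follows. If $P\notin\mathbb N[X_1,\dots,X_n]$, return false. List the set $E=\{a\in B:\rho(a)<s\}$; if it is empty, return true. Otherwise, for each $a\in E$ in turn: list the set $C(a)=\{b\in B: a\preceq b,\ \rho(b)=s\}$; if it is empty, return false; for each $b\in C(a)$ in turn, reject $b$ and go on to the next candidate if $K[Z_b]\cap\operatorname{Ann}M_c\ne0$ for some $c\in\mathcal G[a,b]$, and otherwise return true if $\mathrm{CheckStanleyDepth}(g,s,P-Q[a,b])$ returns true. If no call has returned true, return false. Then, for every order in which the sets are listed, the procedure terminates, and for every $s\in\mathbb N$, started with $P=\sum_{0\preceq a\preceq g}(\dim_KM_a)X^a$, it returns true if and only if $\operatorname{sdepth}M\ge s$. Consequently, if $M\ne0$, then $\operatorname{sdepth}M$ is the largest $s\le n$ for which it returns true, and this number is obtained by an algorithm (one computable function, the same for all $n$, $K$, $M$) from the following finite data: $g$ and the list of all pairs $(a,b)$ with $0\preceq a\preceq b\preceq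 g$ and $X^{b-a}M_a\neq0$. -/

import Mathlib

namespace StanleyDepth

open MvPolynomial

/-! ### Multigraded modules over the polynomial ring `K[X_1, …, X_n]` -/

section Module

variable {n : ℕ} {K M : Type*} [Field K] [AddCommGroup M] [Module K M]
  [Module (MvPolynomial (Fin n) K) M]

/-- The standard `ℤⁿ`-grading of `K[X_1, …, X_n]`, in which `X_i` has degree `e_i`. -/
noncomputable def stdGrading (n : ℕ) (K : Type*) [Field K] :
    (Fin n → ℤ) → Submodule K (MvPolynomial (Fin n) K) :=
  weightedHomogeneousSubmodule K (fun i : Fin n => (Pi.single i 1 : Fin n → ℤ))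

/-- A `ℤⁿ`-grading of the `K[X_1, …, X_n]`-module `M`: `M` is the direct sum of the `K`-subspaces
`M_a`, and multiplication is compatible with the standard grading of the polynomial ring. -/
structure IsMultigrading (𝓜 : (Fin n → ℤ) → Submodule K M) : Prop where
  isInternal : DirectSum.IsInternal 𝓜
  gradedSMul : SetLike.GradedSMul (stdGrading n K) 𝓜

/-- The shifted module `M(u)`, with `M(u)_a = M_{a+u}`. -/
def shift (𝓜 : (Fin n → ℤ) → Submodule K M) (u : Fin n → ℤ) : (Fin n → ℤ) → Submodule K M :=
  fun a => 𝓜 (a + u)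

/-- An exponent vector in `ℕⁿ` as an element of `ℤⁿ`. -/
def toInt (a : Fin n →₀ ℕ) : Fin n → ℤ := fun i => (a i : ℤ)

/-- `M` is positively `g`-determined: it is `ℕⁿ`-graded and multiplication by `X_i` is an
isomorphism `M_a → M_{a+e_i}` whenever `a_i ≥ g_i`. -/
structure IsPositivelyDetermined (𝓜 : (Fin n → ℤ) → Submodule K M) (g : Fin n →₀ ℕ) : Prop where
  eq_bot : ∀ a : Fin n → ℤ, ¬ 0 ≤ a → 𝓜 a = ⊥
  bijOn : ∀ (i : Fin n) (a : Fin n → ℤ), (g i : ℤ) ≤ a i →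
    Set.BijOn (fun m : M => (X i : MvPolynomial (Fin n) K) • m)
      (𝓜 a : Set M) (𝓜 (a + Pi.single i 1) : Set M)

/-! ### Stanley decompositions and Stanley depth -/

/-- The `K`-subspace `m K[Z]` of `M`, where `Z` is a set of variables. -/
noncomputable def stanleySpace [IsScalarTower K (MvPolynomial (Fin n) K) M]
    (m : M) (Z : Finset (Fin n)) : Submodule K M :=
  (Subalgebra.toSubmodule (supported K (Z : Set (Fin n)))).map
    ((LinearMap.toSpanSingleton (MvPolynomial (Fin n) K) M m).restrictScalars K)

/-- `M = ⨁_{i < r} m_i K[Z_i]` is a Stanley decomposition: the `m_i` are homogeneous,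
`K[Z_i] ∩ Ann m_i = 0` for all `i`, and `M` is the direct sum of the subspaces `m_i K[Z_i]`. -/
structure IsStanleyDecomposition [IsScalarTower K (MvPolynomial (Fin n) K) M]
    (𝓜 : (Fin n → ℤ) → Submodule K M)
    {r : ℕ} (m : Fin r → M) (Z : Fin r → Finset (Fin n)) : Prop where
  homogeneous : ∀ i, ∃ a, m i ∈ 𝓜 a
  inter_ann : ∀ i, ∀ f ∈ supported K (Z i : Set (Fin n)), f • m i = 0 → f = 0
  isInternal : DirectSum.IsInternal (fun i => stanleySpace (K := K) (m i) (Z i))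

/-- The Stanley depth of `M`: the largest `s` such that `M` has a Stanley decomposition in which
all polynomial subalgebras involved have at least `s` variables (it is `⊤` if `M = 0`). -/
noncomputable def sdepth [IsScalarTower K (MvPolynomial (Fin n) K) M]
    (𝓜 : (Fin n → ℤ) → Submodule K M) : ℕ∞ :=
  ⨆ (s : ℕ) (_ : ∃ (r : ℕ) (m : Fin r → M) (Z : Fin r → Finset (Fin n)),
    IsStanleyDecomposition 𝓜 m Z ∧ ∀ i, s ≤ (Z i).card), (s : ℕ∞)

/-- The truncated Hilbert series `H_M(X)_{≼ g} = ∑_{0 ≼ a ≼ g} (dim_K M_a) X^a`. -/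
noncomputable def truncatedHilbertSeries (𝓜 : (Fin n → ℤ) → Submodule K M) (g : Fin n →₀ ℕ) :
    MvPolynomial (Fin n) ℤ :=
  ∑ a ∈ Finset.Iic g, monomial a (Module.finrank K (𝓜 (toInt a)) : ℤ)

end Module

/-! ### Intervals -/

section Interval

variable {n : ℕ}

/-- (The indices of) the set of variables `Z_a = {X_j | a_j = g_j}`. -/
def Z (g a : Fin n →₀ ℕ) : Finset (Fin n) := Finset.univ.filter fun j => a j = g j

/-- `ρ(a) = |Z_a|`. -/
def rho (g a : Fin n →₀ ℕ) : ℕ := (Z g a).card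

/-- The polynomial `Q[a,b](X) = ∑_{a ≼ c ≼ b} X^c` induced by the interval `[a,b]`. -/
noncomputable def Q (a b : Fin n →₀ ℕ) : MvPolynomial (Fin n) ℤ :=
  ∑ c ∈ Finset.Icc a b, monomial c 1

/-- `𝒢[a,b] = {c ∈ [a,b] | c_j = a_j for all j with X_j ∈ Z_b}`. -/
noncomputable def G (g a b : Fin n →₀ ℕ) : Finset (Fin n →₀ ℕ) :=
  (Finset.Icc a b).filter fun c => ∀ j ∈ Z g b, c j = a j

/-- `P ∈ ℕ[X_1, …, X_n]`. -/
def HasNatCoeffs (P : MvPolynomial (Fin n) ℤ) : Prop := ∀ c, 0 ≤ P.coeff c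

/-- `B_{<s}`, where `B` is the set of exponents of the monomials of `P`. -/
def elementsToCover (g : Fin n →₀ ℕ) (s : ℕ) (P : MvPolynomial (Fin n) ℤ) :
    Finset (Fin n →₀ ℕ) :=
  P.support.filter fun a => rho g a < s

/-- `B_{=s}(a) = {x ∈ B | a ≼ x, ρ(x) = s}`, where `B` is the set of exponents of the monomials
of `P`. -/
noncomputable def possibleCovers (g : Fin n →₀ ℕ) (s : ℕ) (P : MvPolynomial (Fin n) ℤ)
    (a : Fin n →₀ ℕ) : Finset (Fin n →₀ ℕ) :=
  open Classical in P.support.filter fun x => a ≤ x ∧ rho g x = s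

/-- The two functions `FindElementsToCover` and `FindPossibleCovers`: they list the elements of
`B_{<s}` and of `B_{=s}(a)`, in an arbitrary order. -/
structure Containers (g : Fin n →₀ ℕ) (s : ℕ) where
  elements : MvPolynomial (Fin n) ℤ → List (Fin n →₀ ℕ)
  mem_elements : ∀ P a, a ∈ elements P ↔ a ∈ elementsToCover g s P
  covers : MvPolynomial (Fin n) ℤ → (Fin n →₀ ℕ) → List (Fin n →₀ ℕ)
  mem_covers : ∀ P a b, b ∈ covers P a ↔ b ∈ possibleCovers g s P a

/-- The sum of the positive coefficients of `P`; it decreases along the recursion. -/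
def size (P : MvPolynomial (Fin n) ℤ) : ℕ := ∑ c ∈ P.support, (P.coeff c).toNat

theorem coeff_Q (a b c : Fin n →₀ ℕ) [Decidable (c ∈ Finset.Icc a b)] :
    (Q a b).coeff c = if c ∈ Finset.Icc a b then 1 else 0 := by
  classical
  simp only [Q, coeff_sum, coeff_monomial]
  rw [Finset.sum_ite_eq']
  split_ifs <;> rfl

theorem size_sub_Q_lt {P : MvPolynomial (Fin n) ℤ} (hP : HasNatCoeffs P) {a b : Fin n →₀ ℕ}
    (ha : a ∈ P.support) (hab : a ≤ b) : size (P - Q a b) < size P := by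
  classical
  have key : ∀ R : MvPolynomial (Fin n) ℤ, ∀ S : Finset (Fin n →₀ ℕ), R.support ⊆ S →
      size R = ∑ c ∈ S, (R.coeff c).toNat := by
    intro R S hS
    refine Finset.sum_subset hS fun c _ hc => ?_
    rw [notMem_support_iff.mp hc]; rfl
  rw [key (P - Q a b) (P.support ∪ (P - Q a b).support) Finset.subset_union_right,
    key P (P.support ∪ (P - Q a b).support) Finset.subset_union_left]
  have hc : ∀ c, (P - Q a b).coeff c = P.coeff c - if c ∈ Finset.Icc a b then 1 else 0 := by
    intro c; rw [coeff_sub, coeff_Q]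
  refine Finset.sum_lt_sum (fun c _ => ?_) ⟨a, Finset.mem_union_left _ ha, ?_⟩
  · rw [hc c]; split_ifs <;> omega
  · have h0 := hP a
    have h1 : P.coeff a ≠ 0 := mem_support_iff.mp ha
    rw [hc a, if_pos (Finset.mem_Icc.mpr ⟨le_rfl, hab⟩)]
    omega

end Interval

/-! ### The backtracking procedure -/

/-- The double loop of the procedure. For each `a` in the given list, in order: if its list of
covers `C a` is empty, return `false`; otherwise visit the covers of `a` in order and return `true`
as soon as a visit succeeds. Return `false` when the list is exhausted. -/
def coverLoop {α : Type*} {β : α → Type*} (C : ∀ a, List (β a)) (visit : ∀ a, β a → Bool) :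
    List α → Bool
  | [] => false
  | a :: E =>
    if (C a).isEmpty then false
    else if (C a).any (visit a) then true
    else coverLoop C visit E

section Check

variable {n : ℕ} {K M : Type*} [Field K] [AddCommGroup M] [Module K M]
  [Module (MvPolynomial (Fin n) K) M]

/-- The additional test made on the interval `[a,b]`: `K[Z_b] ∩ Ann M_c = 0` for all
`c ∈ 𝒢[a,b]`. -/
def AnnTest (𝓜 : (Fin n → ℤ) → Submodule K M) (g a b : Fin n →₀ ℕ) : Prop :=
  ∀ c ∈ G g a b, ∀ f ∈ supported K (Z g b : Set (Fin n)),
    (∀ m ∈ 𝓜 (toInt c), f • m = 0) → f = 0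

/-- The recursive function `CheckStanleyDepth(g, s, P)`. A candidate interval `[a,b]` that fails the
annihilator test is rejected, and the search goes on with the next candidate. -/
noncomputable def checkStanleyDepth (𝓜 : (Fin n → ℤ) → Submodule K M) (g : Fin n →₀ ℕ) (s : ℕ)
    (L : Containers g s) (P : MvPolynomial (Fin n) ℤ) : Bool :=
  open Classical in
  if _hP : HasNatCoeffs P then
    if (L.elements P).isEmpty then true
    else
      coverLoop (fun a : {a // a ∈ L.elements P} => (L.covers P a.1).attach)
        (fun a b => decide (AnnTest 𝓜 g a.1 b.1) && checkStanleyDepth 𝓜 g s L (P - Q a.1 b.1))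
        (L.elements P).attach
  else false
termination_by size P
decreasing_by
  have ha := (L.mem_elements P a.1).mp a.2
  have hb := (L.mem_covers P a.1 b.1).mp b.2
  simp only [elementsToCover, possibleCovers, Finset.mem_filter] at ha hb
  exact size_sub_Q_lt _hP ha.1 hb.2.1

/-- The list `T` is the multiplication table of `M` in the degrees `0 ≼ a ≼ g`: it consists of the
pairs `(a,b)` with `0 ≼ a ≼ b ≼ g` and `X^{b-a} M_a ≠ 0`, in any order, where an exponent vector is
written as the list of its coordinates. (So `(a,a)` occurs in `T` if and only if `M_a ≠ 0`.) -/
def IsMultiplicationTable (𝓜 : (Fin n → ℤ) → Submodule K M) (g : Fin n →₀ ℕ)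
    (T : List (List ℕ × List ℕ)) : Prop :=
  ∀ p, p ∈ T ↔ ∃ a b : Fin n →₀ ℕ, a ≤ b ∧ b ≤ g ∧
    (∃ m ∈ 𝓜 (toInt a), (monomial (b - a) 1 : MvPolynomial (Fin n) K) • m ≠ 0) ∧
    p = (List.ofFn a, List.ofFn b)

end Check

end StanleyDepth

namespace StanleyDepth

open MvPolynomial

/-! ### Multigraded modules with components of dimension at most one -/

section Grading

variable {n : ℕ} {K M : Type*} [Field K] [AddCommGroup M] [Module K M]
  [Module (MvPolynomial (Fin n) K) M]

/-! Since every component has dimension at most one, a space `m K[W]` with `m` homogeneous of degree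
`d` and `K[W] ∩ Ann m = 0` is the sum of the components whose degrees lie in the cone `d + ℕ^W`
(`stanleySpace_eq_iSup`). A Stanley decomposition is thus a partition of the degrees of `M` into
such cones (`isInternal_stanleySpace_iff`), and the problem becomes combinatorial.

A cone that meets the box `[0,g]` cuts it in an interval `[a,b]` with `b = g` on `W`. Conversely, an
interval that passes the annihilator test yields the pieces `M_c K[Z_b]` with `c ∈ 𝒢[a,b]`; a degree
`x` outside the box is reached through the interval containing `x ⊓ g`. So a decomposition with all
`|Z_i| ≥ s` exists exactly when the degrees of `M` in the box can be partitioned into tested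
intervals with `ρ(b) ≥ s`.

The procedure only uses intervals with `ρ(b) = s` and leaves exponents with `ρ ≥ s` uncovered.
Nothing is lost: an interval with larger `ρ(b)` splits into intervals with `ρ = s` and elements with
`ρ ≥ s` (`coverable_Q`), and leftover exponents serve as one-point intervals. The search is sound
and complete for such covers (`coverable_of_checkStanleyDepth_eq_true`,
`Coverable.checkStanleyDepth_eq_true`).

The shift and `g` come from bounds on the degrees of generators of `M` and of the kernels of the
multiplications by `X_i`. For computability, a partition coming from a decomposition consists of
intervals with `X^{b-a} M_a ≠ 0`. These are entries of the multiplication table, so a search through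
its sublists with a primitive recursive test suffices. -/

theorem toInt_add (a b : Fin n →₀ ℕ) : toInt (a + b) = toInt a + toInt b := by
  ext i; simp [toInt]

theorem toInt_le_toInt {a b : Fin n →₀ ℕ} : toInt a ≤ toInt b ↔ a ≤ b := by
  simp [toInt, Pi.le_def, Finsupp.le_def]

theorem toInt_injective : Function.Injective (toInt : (Fin n →₀ ℕ) → Fin n → ℤ) := by
  intro a b h
  ext i
  have := congrFun h i
  simpa [toInt] using this

theorem exists_toInt_eq {a : Fin n → ℤ} (ha : 0 ≤ a) : ∃ c : Fin n →₀ ℕ, toInt c = a := by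
  refine ⟨Finsupp.equivFunOnFinite.symm fun i => (a i).toNat, ?_⟩
  ext i
  simpa [toInt] using ha i

theorem exists_add_toInt_eq {d a : Fin n → ℤ} (h : d ≤ a) :
    ∃ v : Fin n →₀ ℕ, a = d + toInt v := by
  obtain ⟨v, hv⟩ := exists_toInt_eq (sub_nonneg.mpr h)
  exact ⟨v, by rw [hv]; abel⟩

theorem weight_single_eq_toInt (v : Fin n →₀ ℕ) :
    Finsupp.weight (fun i : Fin n => (Pi.single i 1 : Fin n → ℤ)) v = toInt v := by
  ext j
  rw [Finsupp.weight_apply, Finsupp.sum_fintype _ _ (by simp)]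
  simp [toInt, Finset.sum_apply, Pi.single_apply]

variable {𝓜 : (Fin n → ℤ) → Submodule K M}

theorem IsMultigrading.monomial_smul_mem (h𝓜 : IsMultigrading 𝓜) {a : Fin n → ℤ} {m : M}
    (hm : m ∈ 𝓜 a) (v : Fin n →₀ ℕ) (k : K) :
    (monomial v k : MvPolynomial (Fin n) K) • m ∈ 𝓜 (a + toInt v) := by
  have h := h𝓜.gradedSMul.smul_mem (i := toInt v) (ai := monomial v k)
    (isWeightedHomogeneous_monomial _ _ _ (weight_single_eq_toInt v)) hm
  rwa [vadd_eq_add, add_comm] at h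

theorem IsMultigrading.monomial_smul_mem_toInt (h𝓜 : IsMultigrading 𝓜) {a b : Fin n →₀ ℕ}
    (hab : a ≤ b) {m : M} (hm : m ∈ 𝓜 (toInt a)) (k : K) :
    (monomial (b - a) k : MvPolynomial (Fin n) K) • m ∈ 𝓜 (toInt b) := by
  have h := h𝓜.monomial_smul_mem hm (b - a) k
  rwa [← toInt_add, add_tsub_cancel_of_le hab] at h

theorem IsMultigrading.iSupIndep (h𝓜 : IsMultigrading 𝓜) : iSupIndep 𝓜 :=
  h𝓜.isInternal.submodule_iSupIndep

theorem IsMultigrading.iSup_eq_top (h𝓜 : IsMultigrading 𝓜) : iSup 𝓜 = ⊤ :=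
  h𝓜.isInternal.submodule_iSup_eq_top

theorem exists_smul_eq_of_rank_le_one {W : Submodule K M} (hW : Module.rank K W ≤ 1) {m x : M}
    (hm : m ∈ W) (hm0 : m ≠ 0) (hx : x ∈ W) : ∃ k : K, k • m = x := by
  obtain ⟨v, -, hv⟩ := (rank_submodule_le_one_iff W).mp hW
  obtain ⟨p, rfl⟩ := Submodule.mem_span_singleton.mp (hv hm)
  obtain ⟨q, rfl⟩ := Submodule.mem_span_singleton.mp (hv hx)
  have hp : p ≠ 0 := by rintro rfl; simp at hm0
  exact ⟨q * p⁻¹, by rw [smul_smul, mul_assoc, inv_mul_cancel₀ hp, mul_one]⟩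

theorem smul_smul_comm' [IsScalarTower K (MvPolynomial (Fin n) K) M]
    (f : MvPolynomial (Fin n) K) (k : K) (m : M) : f • k • m = k • f • m := by
  rw [← algebraMap_smul (MvPolynomial (Fin n) K) k m,
    ← algebraMap_smul (MvPolynomial (Fin n) K) k (f • m), smul_smul, smul_smul, mul_comm]

theorem monomial_smul_eq [IsScalarTower K (MvPolynomial (Fin n) K) M]
    (v : Fin n →₀ ℕ) (k : K) (m : M) :
    (monomial v k : MvPolynomial (Fin n) K) • m
      = k • (monomial v 1 : MvPolynomial (Fin n) K) • m := by
  rw [← smul_assoc, smul_monomial, smul_eq_mul, mul_one]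

omit [Module K M] in
theorem monomial_add_smul (v w : Fin n →₀ ℕ) (m : M) :
    (monomial (v + w) 1 : MvPolynomial (Fin n) K) • m
      = (monomial v 1 : MvPolynomial (Fin n) K) • (monomial w 1 : MvPolynomial (Fin n) K) • m := by
  rw [smul_smul, monomial_mul, mul_one]

/-! ### The supported subalgebras -/

theorem support_subset_of_mem_supported {W : Finset (Fin n)} {f : MvPolynomial (Fin n) K}
    (hf : f ∈ supported K (W : Set (Fin n))) {v : Fin n →₀ ℕ} (hv : v ∈ f.support) :
    v.support ⊆ W := by
  intro i hi
  exact mem_supported.mp hf (mem_vars_iff_mem_support i |>.mpr ⟨v, hv, hi⟩)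

theorem monomial_mem_supported {W : Finset (Fin n)} {v : Fin n →₀ ℕ} (hv : v.support ⊆ W) (k : K) :
    (monomial v k : MvPolynomial (Fin n) K) ∈ supported K (W : Set (Fin n)) := by
  rw [mem_supported]
  by_cases hk : k = 0
  · simp [hk]
  · rw [vars_monomial hk]; exact_mod_cast hv

/-! ### The degrees that occur in `m K[Z]` -/

/-- The degrees `d + v`, where `v` is the degree of a monomial in the variables of `W`. -/
def stanleyDegrees (d : Fin n → ℤ) (W : Finset (Fin n)) : Set (Fin n → ℤ) :=
  {a | d ≤ a ∧ ∀ j ∉ W, a j = d j}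

theorem mem_stanleyDegrees {d a : Fin n → ℤ} {W : Finset (Fin n)} :
    a ∈ stanleyDegrees d W ↔ ∃ v : Fin n →₀ ℕ, v.support ⊆ W ∧ a = d + toInt v := by
  constructor
  · rintro ⟨h1, h2⟩
    obtain ⟨v, rfl⟩ := exists_add_toInt_eq h1
    refine ⟨v, fun j hj => ?_, rfl⟩
    by_contra hjW
    have := h2 j hjW
    simp [toInt] at this
    simp [this] at hj
  · rintro ⟨v, hv, rfl⟩
    refine ⟨fun j => by simp [toInt], fun j hj => ?_⟩
    have : v j = 0 := Finsupp.notMem_support_iff.mp fun h => hj (hv h)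
    simp [toInt, this]

variable [IsScalarTower K (MvPolynomial (Fin n) K) M]

/-- For `v` supported in `W` the element `X^v m` is nonzero, hence spans its component, which has
dimension at most one. -/
theorem stanleySpace_eq_iSup (h𝓜 : IsMultigrading 𝓜) (hdim : ∀ a, Module.rank K (𝓜 a) ≤ 1)
    {d : Fin n → ℤ} {m : M} (hm : m ∈ 𝓜 d) {W : Finset (Fin n)}
    (hW : ∀ f ∈ supported K (W : Set (Fin n)), f • m = 0 → f = 0) :
    stanleySpace (K := K) m W = ⨆ a ∈ stanleyDegrees d W, 𝓜 a := by
  apply le_antisymm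
  · rintro _ ⟨f, hf, rfl⟩
    simp only [LinearMap.coe_restrictScalars, LinearMap.toSpanSingleton_apply]
    rw [f.as_sum, Finset.sum_smul]
    refine Submodule.sum_mem _ fun v hv => ?_
    refine Submodule.mem_iSup_of_mem (d + toInt v) (Submodule.mem_iSup_of_mem ?_
      (h𝓜.monomial_smul_mem hm v _))
    exact mem_stanleyDegrees.mpr ⟨v, support_subset_of_mem_supported hf hv, rfl⟩
  · refine iSup₂_le fun a ha x hx => ?_
    obtain ⟨v, hv, rfl⟩ := mem_stanleyDegrees.mp ha
    have hne : (monomial v 1 : MvPolynomial (Fin n) K) • m ≠ 0 := fun h =>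
      one_ne_zero (monomial_eq_zero.mp (hW _ (monomial_mem_supported hv 1) h))
    obtain ⟨k, rfl⟩ := exists_smul_eq_of_rank_le_one (hdim _) (h𝓜.monomial_smul_mem hm v 1) hne hx
    exact ⟨monomial v k, monomial_mem_supported hv k, by simp [monomial_smul_eq v k m]⟩

omit [IsScalarTower K (MvPolynomial (Fin n) K) M] in
theorem ne_bot_of_mem_stanleyDegrees (h𝓜 : IsMultigrading 𝓜)
    {d : Fin n → ℤ} {m : M} (hm : m ∈ 𝓜 d) {W : Finset (Fin n)}
    (hW : ∀ f ∈ supported K (W : Set (Fin n)), f • m = 0 → f = 0) {a : Fin n → ℤ}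
    (ha : a ∈ stanleyDegrees d W) : 𝓜 a ≠ ⊥ := by
  obtain ⟨v, hv, rfl⟩ := mem_stanleyDegrees.mp ha
  intro h
  have h1 := h𝓜.monomial_smul_mem hm v 1
  rw [h, Submodule.mem_bot] at h1
  exact one_ne_zero (monomial_eq_zero.mp (hW _ (monomial_mem_supported hv 1) h1))

/-- A family of subspaces `m_i K[Z_i]` with `K[Z_i] ∩ Ann m_i = 0` decomposes `M` if and only if
every degree of `M` belongs to exactly one of them. -/
theorem isInternal_stanleySpace_iff (h𝓜 : IsMultigrading 𝓜)
    (hdim : ∀ a, Module.rank K (𝓜 a) ≤ 1) {ι : Type*} [DecidableEq ι]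
    {d : ι → Fin n → ℤ} {m : ι → M} {W : ι → Finset (Fin n)} (hm : ∀ i, m i ∈ 𝓜 (d i))
    (hW : ∀ i, ∀ f ∈ supported K (W i : Set (Fin n)), f • m i = 0 → f = 0) :
    DirectSum.IsInternal (fun i => stanleySpace (K := K) (m i) (W i)) ↔
      ∀ a, 𝓜 a ≠ ⊥ → ∃! i, a ∈ stanleyDegrees (d i) (W i) := by
  have hS : (fun i => stanleySpace (K := K) (m i) (W i))
      = fun i => ⨆ a ∈ stanleyDegrees (d i) (W i), 𝓜 a :=
    funext fun i => stanleySpace_eq_iSup h𝓜 hdim (hm i) (hW i)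
  rw [hS, DirectSum.isInternal_submodule_iff_iSupIndep_and_iSup_eq_top]
  constructor
  · rintro ⟨hind, htop⟩ a ha
    refine existsUnique_of_exists_of_unique ?_ fun i j hi hj => ?_
    -- If no cone contained `a`, all pieces would lie in the sum of the other components, which
    -- would then be all of `M`.
    · by_contra! hno
      apply ha
      have h1 : (⨆ i, ⨆ a ∈ stanleyDegrees (d i) (W i), 𝓜 a) ≤ ⨆ (b) (_ : b ≠ a), 𝓜 b := by
        refine iSup_le fun i => iSup₂_le fun b hb => ?_
        exact le_iSup₂_of_le b (by rintro rfl; exact hno i hb) le_rfl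
      have h2 := h𝓜.iSupIndep a
      rwa [eq_top_iff.mpr (htop.symm.le.trans h1), disjoint_top] at h2
    · by_contra hij
      exact ha (le_bot_iff.mp (hind.pairwiseDisjoint hij
        (le_iSup₂_of_le (f := fun b (_ : b ∈ stanleyDegrees (d i) (W i)) => 𝓜 b) a hi le_rfl)
        (le_iSup₂_of_le (f := fun b (_ : b ∈ stanleyDegrees (d j) (W j)) => 𝓜 b) a hj le_rfl)))
  · intro h
    refine ⟨fun i => ?_, ?_⟩
    -- All degrees of a cone are degrees of `M`, so uniqueness keeps the other cones off the cone of
    -- `i`.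
    · have h1 : (⨆ (j) (_ : j ≠ i), ⨆ a ∈ stanleyDegrees (d j) (W j), 𝓜 a)
          ≤ ⨆ b ∈ (stanleyDegrees (d i) (W i))ᶜ, 𝓜 b := by
        refine iSup₂_le fun j hj => iSup₂_le fun b hb => ?_
        refine le_iSup₂_of_le b (fun hbi => hj ?_) le_rfl
        exact (h b (ne_bot_of_mem_stanleyDegrees h𝓜 (hm j) (hW j) hb)).unique hb hbi
      exact (h𝓜.iSupIndep.disjoint_biSup_biSup disjoint_compl_right).mono_right h1
    · rw [eq_top_iff, ← h𝓜.iSup_eq_top]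
      refine iSup_le fun a => ?_
      by_cases ha : 𝓜 a = ⊥
      · simp [ha]
      · obtain ⟨i, hi, -⟩ := h a ha
        exact le_iSup_of_le i (le_iSup₂_of_le a hi le_rfl)

end Grading

/-! ### Multiplication between two degrees -/

section Mult

variable {n : ℕ} {K M : Type*} [Field K] [AddCommGroup M] [Module K M]
  [Module (MvPolynomial (Fin n) K) M]

/-- Multiplication by `X^{b-a}` from degree `a` to degree `b` is nonzero. -/
def MulNonzero (𝓜 : (Fin n → ℤ) → Submodule K M) (a b : Fin n →₀ ℕ) : Prop :=
  a ≤ b ∧ ∃ m ∈ 𝓜 (toInt a), (monomial (b - a) 1 : MvPolynomial (Fin n) K) • m ≠ 0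

variable {𝓜 : (Fin n → ℤ) → Submodule K M}

theorem mulNonzero_self_iff (a : Fin n →₀ ℕ) : MulNonzero 𝓜 a a ↔ 𝓜 (toInt a) ≠ ⊥ := by
  rw [Submodule.ne_bot_iff]
  simp [MulNonzero, monomial_zero']

theorem MulNonzero.left_right {a b c : Fin n →₀ ℕ} (h : MulNonzero 𝓜 a b) (h𝓜 : IsMultigrading 𝓜)
    (hac : a ≤ c) (hcb : c ≤ b) : MulNonzero 𝓜 a c ∧ MulNonzero 𝓜 c b := by
  obtain ⟨-, x, hx, hx0⟩ := h
  have : b - a = (b - c) + (c - a) := by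
    ext i
    have h1 := hac i
    have h2 := hcb i
    simp only [Finsupp.coe_tsub, Pi.sub_apply, Finsupp.coe_add, Pi.add_apply]
    omega
  rw [this, monomial_add_smul] at hx0
  exact ⟨⟨hac, x, hx, right_ne_zero_of_smul hx0⟩,
    ⟨hcb, _, h𝓜.monomial_smul_mem_toInt hac hx 1, hx0⟩⟩

theorem MulNonzero.middle {a b c d : Fin n →₀ ℕ} (h : MulNonzero 𝓜 a b) (h𝓜 : IsMultigrading 𝓜)
    (hac : a ≤ c) (hcd : c ≤ d) (hdb : d ≤ b) : MulNonzero 𝓜 c d :=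
  ((h.left_right h𝓜 hac (hcd.trans hdb)).2.left_right h𝓜 hcd hdb).1

/-- Compose the bijections for single variables; degrees only grow along the way, so the bound by
`g` persists. -/
theorem IsPositivelyDetermined.bijOn_monomial {g : Fin n →₀ ℕ} (hg : IsPositivelyDetermined 𝓜 g)
    (v : Fin n →₀ ℕ) : ∀ d : Fin n → ℤ, (∀ j ∈ v.support, (g j : ℤ) ≤ d j) →
    Set.BijOn (fun m : M => (monomial v 1 : MvPolynomial (Fin n) K) • m)
      (𝓜 d : Set M) (𝓜 (d + toInt v) : Set M) := by
  induction v using Finsupp.induction_linear with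
  | zero =>
    intro d _
    have : toInt (0 : Fin n →₀ ℕ) = 0 := by ext; simp [toInt]
    simp only [monomial_zero', map_one, one_smul, this, add_zero]
    exact Set.bijOn_id _
  | add v w hv hw =>
    intro d hd
    have hw' := hw d fun j hj => hd j (by simp at hj ⊢; omega)
    have hv' := hv (d + toInt w) fun j hj =>
      (hd j (by simp at hj ⊢; omega)).trans (by simp [toInt])
    have := hv'.comp hw'
    rw [add_assoc, ← toInt_add, add_comm w v] at this
    refine this.congr fun m _ => ?_
    exact (monomial_add_smul v w m).symm
  | single i k =>
    induction k with
    | zero =>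
      intro d _
      have : toInt (0 : Fin n →₀ ℕ) = 0 := by ext; simp [toInt]
      simp only [Finsupp.single_zero, monomial_zero', map_one, one_smul, this, add_zero]
      exact Set.bijOn_id _
    | succ k ih =>
      intro d hd
      have hdi : (g i : ℤ) ≤ d i := hd i (by simp)
      have h1 := ih d fun j hj => by
        obtain rfl : j = i := by
          by_contra h; simp [Ne.symm h] at hj
        exact hdi
      have h2 := hg.bijOn i (d + toInt (Finsupp.single i k)) (hdi.trans (by simp [toInt]))
      have h3 := h2.comp h1
      have h4 : d + toInt (Finsupp.single i k) + Pi.single i 1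
          = d + toInt (Finsupp.single i (k + 1)) := by
        rw [Finsupp.single_add, toInt_add, add_assoc]
        congr 2
        ext j
        simp [toInt, Finsupp.single_apply, Pi.single_apply, eq_comm]
      rw [h4] at h3
      refine h3.congr fun m _ => ?_
      simp only [Function.comp]
      rw [add_comm k 1, Finsupp.single_add, monomial_add_smul]
      rfl

/-- Only coordinates with `a_j > g_j` change, and there `a ⊓ g` already equals `g_j`, so
multiplication is bijective between the two degrees. -/
theorem IsPositivelyDetermined.mulNonzero_inf {g : Fin n →₀ ℕ}
    (hg : IsPositivelyDetermined 𝓜 g) {a : Fin n →₀ ℕ} (ha : 𝓜 (toInt a) ≠ ⊥) :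
    𝓜 (toInt (a ⊓ g)) ≠ ⊥ := by
  intro h
  apply ha
  have h1 := hg.bijOn_monomial (a - a ⊓ g) (toInt (a ⊓ g)) fun j hj => by
    simp only [Finsupp.mem_support_iff, Finsupp.coe_tsub, Pi.sub_apply, Finsupp.inf_apply] at hj
    simp only [toInt, Finsupp.inf_apply]
    omega
  rw [← toInt_add, add_tsub_cancel_of_le inf_le_left] at h1
  rw [eq_bot_iff]
  intro x hx
  obtain ⟨y, hy, rfl⟩ := h1.surjOn hx
  rw [h] at hy
  have : y = 0 := by simpa using hy
  simp [this]

variable [IsScalarTower K (MvPolynomial (Fin n) K) M]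

/-- If `X^{d-c} M_c ≠ 0` and `d_j ≥ g_j` for the variables `X_j` in `W`, then
`K[W] ∩ Ann M_c = 0`. -/
theorem MulNonzero.eq_zero_of_smul_eq_zero (h𝓜 : IsMultigrading 𝓜) {g : Fin n →₀ ℕ}
    (hg : IsPositivelyDetermined 𝓜 g) {c d : Fin n →₀ ℕ} (h : MulNonzero 𝓜 c d)
    {W : Finset (Fin n)} (hW : ∀ j ∈ W, g j ≤ d j) {f : MvPolynomial (Fin n) K}
    (hf : f ∈ supported K (W : Set (Fin n))) (hfm : ∀ m ∈ 𝓜 (toInt c), f • m = 0) : f = 0 := by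
  obtain ⟨hcd, m, hm, hm0⟩ := h
  set x := (monomial (d - c) 1 : MvPolynomial (Fin n) K) • m with hx
  have hxmem : x ∈ 𝓜 (toInt d) := h𝓜.monomial_smul_mem_toInt hcd hm 1
  have hfx : f • x = 0 := by rw [hx, smul_smul, mul_comm, mul_smul, hfm m hm, smul_zero]
  -- The terms of `f • x` have distinct degrees, so each vanishes; but a monomial in the variables
  -- of `W` acts injectively on degree `d`.
  rw [f.as_sum, Finset.sum_smul] at hfx
  have hind : iSupIndep fun v : Fin n →₀ ℕ => 𝓜 (toInt d + toInt v) :=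
    h𝓜.iSupIndep.comp (f := fun v : Fin n →₀ ℕ => toInt d + toInt v)
      fun v w hvw => toInt_injective (add_left_cancel hvw)
  have hall := (iSupIndep_iff_finsetSum_eq_zero_imp_eq_zero _).mp hind f.support
    (fun v => (monomial v (coeff v f) : MvPolynomial (Fin n) K) • x)
    (fun v _ => h𝓜.monomial_smul_mem hxmem v _) hfx
  by_contra hf0
  obtain ⟨v, hv⟩ := Finset.nonempty_iff_ne_empty.mpr (mt support_eq_empty.mp hf0)
  have h1 := hall v hv
  rw [monomial_smul_eq, smul_eq_zero_iff_right (mem_support_iff.mp hv)] at h1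
  have hinj := (hg.bijOn_monomial v (toInt d) fun j hj => by
    exact Int.ofNat_le.mpr (hW j (support_subset_of_mem_supported hf hv hj))).injOn
  exact hm0 (hinj hxmem (zero_mem _) (by simpa using h1))

/-- Nonvanishing on `[a,b]` makes every subinterval pass the test, which is what allows intervals to
be split. -/
theorem MulNonzero.annTest (h𝓜 : IsMultigrading 𝓜) {g : Fin n →₀ ℕ}
    (hg : IsPositivelyDetermined 𝓜 g) {a b a' b' : Fin n →₀ ℕ} (h : MulNonzero 𝓜 a b)
    (ha : a ≤ a') (hb : b' ≤ b) : AnnTest 𝓜 g a' b' := by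
  intro c hc f hf hfm
  have hc' := Finset.mem_Icc.mp (Finset.mem_filter.mp hc).1
  refine (h.left_right h𝓜 (ha.trans hc'.1) (hc'.2.trans hb)).2.eq_zero_of_smul_eq_zero h𝓜 hg
    (W := Z g b') (fun j hj => ?_) hf hfm
  simp only [Z, Finset.mem_filter, Finset.mem_univ, true_and] at hj
  exact hj ▸ hb j

end Mult

/-! ### Correctness of the backtracking search -/

section Search

theorem coverLoop_eq_true {α : Type*} {β : α → Type*} {C : ∀ a, List (β a)}
    {visit : ∀ a, β a → Bool} (E : List α) (h : coverLoop C visit E = true) :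
    ∃ a ∈ E, ∃ b ∈ C a, visit a b = true := by
  induction E with
  | nil => simp [coverLoop] at h
  | cons a E ih =>
    rw [coverLoop] at h
    split_ifs at h with h1 h2
    · obtain ⟨b, hb, hv⟩ := List.any_eq_true.mp h2
      exact ⟨a, List.mem_cons_self, b, hb, hv⟩
    · obtain ⟨a', ha', hb⟩ := ih h
      exact ⟨a', List.mem_cons_of_mem _ ha', hb⟩

/-- The hypothesis `hC` rules out the early exit with `false`, which could otherwise hide a later
success. -/
theorem coverLoop_eq_true_of_exists {α : Type*} {β : α → Type*} {C : ∀ a, List (β a)}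
    {visit : ∀ a, β a → Bool} (E : List α) (hC : ∀ a ∈ E, C a ≠ [])
    (h : ∃ a ∈ E, ∃ b ∈ C a, visit a b = true) : coverLoop C visit E = true := by
  induction E with
  | nil => simp at h
  | cons a E ih =>
    rw [coverLoop, if_neg (by simpa using hC a List.mem_cons_self)]
    split_ifs with h2
    · rfl
    · refine ih (fun a' ha' => hC a' (List.mem_cons_of_mem _ ha')) ?_
      obtain ⟨a', ha', b, hb, hv⟩ := h
      rcases List.mem_cons.mp ha' with rfl | ha'
      · exact absurd (List.any_eq_true.mpr ⟨b, hb, hv⟩) h2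
      · exact ⟨a', ha', b, hb, hv⟩

variable {n : ℕ}

theorem mem_Z {g a : Fin n →₀ ℕ} {j : Fin n} : j ∈ Z g a ↔ a j = g j := by simp [Z]

theorem Z_subset_Z {g a b : Fin n →₀ ℕ} (hab : a ≤ b) (hb : b ≤ g) : Z g a ⊆ Z g b := by
  intro j hj
  rw [mem_Z] at hj ⊢
  exact le_antisymm (hb j) (hj ▸ hab j)

theorem rho_mono {g a b : Fin n →₀ ℕ} (hab : a ≤ b) (hb : b ≤ g) : rho g a ≤ rho g b :=
  Finset.card_le_card (Z_subset_Z hab hb)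

-- Coefficients count the intervals through `c`, which turns identities of polynomials into
-- statements about covering multiplicities.
open Classical in
theorem coeff_sum_Q (𝒮 : Multiset ((Fin n →₀ ℕ) × (Fin n →₀ ℕ))) (c : Fin n →₀ ℕ) :
    ((𝒮.map fun p => Q p.1 p.2).sum).coeff c
      = (𝒮.filter fun p => p.1 ≤ c ∧ c ≤ p.2).card := by
  induction 𝒮 using Multiset.induction_on with
  | empty => simp
  | cons p 𝒮 ih =>
    rw [Multiset.map_cons, Multiset.sum_cons, coeff_add, ih, coeff_Q, Multiset.filter_cons]
    simp only [Finset.mem_Icc]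
    split_ifs <;> simp [add_comm]

variable {K M : Type*} [Field K] [AddCommGroup M] [Module K M]
  [Module (MvPolynomial (Fin n) K) M]

/-- `P` is a sum of polynomials `Q[a,b]` of intervals that pass the tests of the procedure, up to
monomials that need not be covered. -/
def Coverable (𝓜 : (Fin n → ℤ) → Submodule K M) (g : Fin n →₀ ℕ) (s : ℕ)
    (P : MvPolynomial (Fin n) ℤ) : Prop :=
  ∃ (𝒮 : Multiset ((Fin n →₀ ℕ) × (Fin n →₀ ℕ))) (R : MvPolynomial (Fin n) ℤ),
    P = (𝒮.map fun p => Q p.1 p.2).sum + R ∧ HasNatCoeffs R ∧ (∀ c ∈ R.support, s ≤ rho g c) ∧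
    ∀ p ∈ 𝒮, p.1 ≤ p.2 ∧ p.2 ≤ g ∧ rho g p.2 = s ∧ AnnTest 𝓜 g p.1 p.2

variable {𝓜 : (Fin n → ℤ) → Submodule K M} {g : Fin n →₀ ℕ} {s : ℕ}

/-- Nonnegative coefficients cannot cancel. -/
theorem HasNatCoeffs.mem_support_add {P P' : MvPolynomial (Fin n) ℤ} (h : HasNatCoeffs P)
    (h' : HasNatCoeffs P') {c : Fin n →₀ ℕ} :
    c ∈ (P + P').support ↔ c ∈ P.support ∨ c ∈ P'.support := by
  have h1 := h c
  have h2 := h' c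
  simp only [mem_support_iff, coeff_add]
  omega

theorem HasNatCoeffs.add {P P' : MvPolynomial (Fin n) ℤ} (h : HasNatCoeffs P)
    (h' : HasNatCoeffs P') : HasNatCoeffs (P + P') := fun c => by
  rw [coeff_add]; exact add_nonneg (h c) (h' c)

theorem hasNatCoeffs_Q (a b : Fin n →₀ ℕ) : HasNatCoeffs (Q a b) := fun c => by
  classical
  rw [coeff_Q]; split_ifs <;> simp

theorem mem_support_Q {a b c : Fin n →₀ ℕ} : c ∈ (Q a b).support ↔ a ≤ c ∧ c ≤ b := by
  classical
  rw [mem_support_iff, coeff_Q]; simp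

theorem Coverable.add {P P' : MvPolynomial (Fin n) ℤ} (h : Coverable 𝓜 g s P)
    (h' : Coverable 𝓜 g s P') : Coverable 𝓜 g s (P + P') := by
  obtain ⟨𝒮, R, rfl, hR, hRs, h𝒮⟩ := h
  obtain ⟨𝒮', R', rfl, hR', hRs', h𝒮'⟩ := h'
  refine ⟨𝒮 + 𝒮', R + R', ?_, hR.add hR', fun c hc => ?_, fun p hp => ?_⟩
  · rw [Multiset.map_add, Multiset.sum_add]; ring
  · exact ((hR.mem_support_add hR').mp hc).elim (hRs c) (hRs' c)
  · exact (Multiset.mem_add.mp hp).elim (h𝒮 p) (h𝒮' p)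

theorem Coverable.sum {ι : Type*} (S : Finset ι) (P : ι → MvPolynomial (Fin n) ℤ)
    (h : ∀ i ∈ S, Coverable 𝓜 g s (P i)) : Coverable 𝓜 g s (∑ i ∈ S, P i) := by
  refine Finset.sum_induction _ _ (fun _ _ => Coverable.add) ?_ h
  exact ⟨0, 0, by simp, fun c => by simp, by simp, by simp⟩

theorem Coverable.hasNatCoeffs {P : MvPolynomial (Fin n) ℤ} (h : Coverable 𝓜 g s P) :
    HasNatCoeffs P := by
  obtain ⟨𝒮, R, rfl, hR, -⟩ := h
  refine HasNatCoeffs.add (fun c => ?_) hR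
  rw [coeff_sum_Q]
  positivity

/-- Completeness of the search, by induction on the number of intervals: removing one of them leaves
a coverable polynomial, and it does not matter whether another candidate succeeds earlier. -/
theorem Coverable.checkStanleyDepth_eq_true (L : Containers g s) {P : MvPolynomial (Fin n) ℤ}
    (h : Coverable 𝓜 g s P) : checkStanleyDepth 𝓜 g s L P = true := by
  classical
  obtain ⟨𝒮, R, hP, hR, hRs, h𝒮⟩ := h
  induction hk : 𝒮.card generalizing 𝒮 P with
  | zero =>
    have hnat : HasNatCoeffs P := Coverable.hasNatCoeffs ⟨𝒮, R, hP, hR, hRs, h𝒮⟩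
    obtain rfl := Multiset.card_eq_zero.mp hk
    rw [checkStanleyDepth, dif_pos hnat, if_pos]
    rw [List.isEmpty_iff, List.eq_nil_iff_forall_not_mem]
    intro a ha
    have ha' := Finset.mem_filter.mp ((L.mem_elements P a).mp ha)
    rw [hP, Multiset.map_zero, Multiset.sum_zero, zero_add] at ha'
    exact absurd (hRs a ha'.1) (by omega)
  | succ k ih =>
    have hnat : HasNatCoeffs P := Coverable.hasNatCoeffs ⟨𝒮, R, hP, hR, hRs, h𝒮⟩
    rw [checkStanleyDepth, dif_pos hnat]
    split_ifs with hE
    · rfl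
    -- The remainder `R` has no exponent with `ρ < s`, so `a` lies in some interval `p`. Its upper
    -- end is a candidate for `a`, and its lower end is itself an element to cover because `ρ` is
    -- monotone.
    have hcov : ∀ a ∈ L.elements P, ∃ p ∈ 𝒮, p.1 ≤ a ∧ p.1 ∈ L.elements P ∧
        p.2 ∈ L.covers P a ∧ p.2 ∈ L.covers P p.1 := by
      intro a ha
      have ha' := Finset.mem_filter.mp ((L.mem_elements P a).mp ha)
      have hRa : R.coeff a = 0 := by
        by_contra hne
        exact absurd (hRs a (mem_support_iff.mpr hne)) (by omega)
      have hcard := mem_support_iff.mp ha'.1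
      rw [hP, coeff_add, hRa, add_zero, coeff_sum_Q] at hcard
      obtain ⟨p, hp⟩ := Multiset.card_pos_iff_exists_mem.mp
        (Nat.pos_of_ne_zero (by exact_mod_cast hcard))
      rw [Multiset.mem_filter] at hp
      obtain ⟨hp, hpa, hap⟩ := hp
      obtain ⟨hle, hpg, hps, -⟩ := h𝒮 p hp
      have hsupp : ∀ c, p.1 ≤ c → c ≤ p.2 → c ∈ P.support := by
        intro c h1 h2
        rw [mem_support_iff, hP, coeff_add, coeff_sum_Q]
        have : 0 < (𝒮.filter fun p => p.1 ≤ c ∧ c ≤ p.2).card :=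
          Multiset.card_pos_iff_exists_mem.mpr ⟨p, Multiset.mem_filter.mpr ⟨hp, h1, h2⟩⟩
        have := hR c
        omega
      refine ⟨p, hp, hpa, (L.mem_elements _ _).mpr (Finset.mem_filter.mpr
        ⟨hsupp _ le_rfl hle, (rho_mono hpa (hap.trans hpg)).trans_lt ha'.2⟩), ?_, ?_⟩ <;>
      rw [L.mem_covers, possibleCovers, Finset.mem_filter]
      · exact ⟨hsupp _ hle le_rfl, hap, hps⟩
      · exact ⟨hsupp _ hle le_rfl, hle, hps⟩
    apply coverLoop_eq_true_of_exists
    · rintro ⟨a, ha⟩ -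
      obtain ⟨p, -, -, -, hpa, -⟩ := hcov a ha
      simpa using List.ne_nil_of_mem hpa
    · obtain ⟨a, ha⟩ := List.exists_mem_of_ne_nil _ (by simpa using hE)
      obtain ⟨p, hp, -, hp1, -, hp2⟩ := hcov a ha
      refine ⟨⟨p.1, hp1⟩, List.mem_attach _ _, ⟨p.2, hp2⟩, List.mem_attach _ _, ?_⟩
      rw [Bool.and_eq_true, decide_eq_true_eq]
      refine ⟨(h𝒮 p hp).2.2.2, ih (𝒮.erase p) ?_
        (fun q hq => h𝒮 q (Multiset.mem_of_mem_erase hq)) ?_⟩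
      · change P - Q p.1 p.2 = _
        rw [hP]
        conv_lhs => rw [← Multiset.cons_erase hp, Multiset.map_cons, Multiset.sum_cons]
        ring
      · rw [Multiset.card_erase_of_mem hp, hk]; rfl

/-- Soundness of the search: a successful run is retraced, each recursive call contributing the
interval it subtracted and the final exponents forming `R`. -/
theorem coverable_of_checkStanleyDepth_eq_true (L : Containers g s) (P : MvPolynomial (Fin n) ℤ)
    (hPg : ∀ c ∈ P.support, c ≤ g) (h : checkStanleyDepth 𝓜 g s L P = true) :
    Coverable 𝓜 g s P := by
  classical
  induction hk : size P using Nat.strong_induction_on generalizing P with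
  | _ k ih =>
    rw [checkStanleyDepth] at h
    split_ifs at h with hnat hE
    · refine ⟨0, P, by simp, hnat, fun c hc => ?_, by simp⟩
      by_contra hlt
      have : c ∈ L.elements P :=
        (L.mem_elements P c).mpr (Finset.mem_filter.mpr ⟨hc, not_le.mp hlt⟩)
      rw [List.isEmpty_iff.mp hE] at this
      simp at this
    · obtain ⟨⟨a, ha⟩, -, ⟨b, hb⟩, -, hv⟩ := coverLoop_eq_true _ h
      rw [Bool.and_eq_true, decide_eq_true_eq] at hv
      obtain ⟨hann, hv⟩ := hv
      have ha' := (L.mem_elements P a).mp ha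
      have hb' := (L.mem_covers P a b).mp hb
      simp only [elementsToCover, possibleCovers, Finset.mem_filter] at ha' hb'
      -- A call that returns `true` has passed its initial test on coefficients.
      have hnat' : HasNatCoeffs (P - Q a b) := by
        rw [checkStanleyDepth] at hv
        split_ifs at hv with h1 <;> exact h1
      have hPeq : Q a b + (P - Q a b) = P := by ring
      rw [← hPeq]
      refine Coverable.add ⟨{(a, b)}, 0, by simp, fun c => by simp, by simp, ?_⟩
        (ih _ (hk ▸ size_sub_Q_lt hnat ha'.1 hb'.2.1) _ (fun c hc => hPg c ?_) hv rfl)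
      · simp only [Multiset.mem_singleton]
        rintro p rfl
        exact ⟨hb'.2.1, hPg b hb'.1, hb'.2.2, hann⟩
      · rw [← hPeq]
        exact ((hasNatCoeffs_Q a b).mem_support_add hnat').mpr (Or.inr hc)

/-- An interval whose upper end has `ρ ≥ s` splits into intervals whose upper end has `ρ = s` and
into elements with `ρ ≥ s`. -/
theorem coverable_Q {a b : Fin n →₀ ℕ} (hab : a ≤ b) (hbg : b ≤ g) (hb : s ≤ rho g b)
    (hann : ∀ a' b', a ≤ a' → b' ≤ b → AnnTest 𝓜 g a' b') : Coverable 𝓜 g s (Q a b) := by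
  classical
  induction hk : ∑ i, (b i - a i) using Nat.strong_induction_on generalizing a b with
  | _ k ih =>
    by_cases ha : s ≤ rho g a
    · refine ⟨0, Q a b, by simp, hasNatCoeffs_Q a b, fun c hc => ?_, by simp⟩
      rw [mem_support_Q] at hc
      exact ha.trans (rho_mono hc.1 (hc.2.trans hbg))
    by_cases hbs : rho g b = s
    · refine ⟨{(a, b)}, 0, by simp, fun c => by simp, by simp, ?_⟩
      simp only [Multiset.mem_singleton]
      rintro p rfl
      exact ⟨hab, hbg, hbs, hann a b le_rfl le_rfl⟩
    -- Here `ρ(a) < s < ρ(b)`, so some coordinate reaches `g` at `b` but not at `a`.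
    obtain ⟨j, hjb, hja⟩ : ∃ j ∈ Z g b, j ∉ Z g a := by
      by_contra! hsub
      have : rho g b ≤ rho g a := Finset.card_le_card hsub
      omega
    rw [mem_Z] at hjb hja
    have haj : a j < g j := lt_of_le_of_ne (hjb ▸ hab j) hja
    -- Cut `[a,b]` into the parts `c_j < g_j` and `c_j = g_j`. The first has upper end `b'` with
    -- `ρ(b') = ρ(b) - 1 ≥ s`; the second keeps `b`.
    set a' := a.update j (g j) with ha'
    set b' := b.update j (g j - 1) with hb'
    have ha'a : ∀ i, a' i = if i = j then g j else a i := fun i => by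
      simp [ha', Function.update_apply]
    have hb'b : ∀ i, b' i = if i = j then g j - 1 else b i := fun i => by
      simp [hb', Function.update_apply]
    have haa' : a ≤ a' := fun i => by
      rw [ha'a]; split_ifs with h
      · subst h; exact haj.le
      · exact le_rfl
    have hb'b' : b' ≤ b := fun i => by
      rw [hb'b]; split_ifs with h
      · subst h; omega
      · exact le_rfl
    have ha'b : a' ≤ b := fun i => by
      rw [ha'a]; split_ifs with h
      · subst h; exact hjb.ge
      · exact hab i
    have hab' : a ≤ b' := fun i => by
      rw [hb'b]; split_ifs with h
      · subst h; omega
      · exact hab i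
    have hZ : Z g b' = (Z g b).erase j := by
      ext i
      rw [Finset.mem_erase, mem_Z, mem_Z, hb'b]
      split_ifs with h
      · subst h; simp; omega
      · simp [h]
    have hrho : rho g b' = rho g b - 1 := by
      rw [rho, hZ, Finset.card_erase_of_mem (mem_Z.mpr hjb)]; rfl
    have hQ : Q a b = Q a b' + Q a' b := by
      ext c
      rw [coeff_add, coeff_Q, coeff_Q, coeff_Q]
      have h1 : c ∈ Finset.Icc a b' ↔ c ∈ Finset.Icc a b ∧ c j < g j := by
        simp only [Finset.mem_Icc]
        constructor
        · rintro ⟨h1, h2⟩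
          have := h2 j
          rw [hb'b, if_pos rfl] at this
          exact ⟨⟨h1, h2.trans hb'b'⟩, by omega⟩
        · rintro ⟨⟨h1, h2⟩, h3⟩
          refine ⟨h1, fun i => ?_⟩
          rw [hb'b]; split_ifs with h
          · subst h; omega
          · exact h2 i
      have h2 : c ∈ Finset.Icc a' b ↔ c ∈ Finset.Icc a b ∧ ¬ c j < g j := by
        simp only [Finset.mem_Icc]
        constructor
        · rintro ⟨h1, h2⟩
          have := h1 j
          rw [ha'a, if_pos rfl] at this
          exact ⟨⟨haa'.trans h1, h2⟩, by omega⟩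
        · rintro ⟨⟨h1, h2⟩, h3⟩
          refine ⟨fun i => ?_, h2⟩
          rw [ha'a]; split_ifs with h
          · subst h; omega
          · exact h1 i
      simp only [h1, h2]
      by_cases h3 : c ∈ Finset.Icc a b <;> by_cases h4 : c j < g j <;> simp [h3, h4]
    rw [hQ]
    have hlt1 : ∑ i, (b' i - a i) < ∑ i, (b i - a i) :=
      Finset.sum_lt_sum (fun i _ => Nat.sub_le_sub_right (hb'b' i) _)
        ⟨j, Finset.mem_univ _, by rw [hb'b, if_pos rfl]; omega⟩
    have hlt2 : ∑ i, (b i - a' i) < ∑ i, (b i - a i) :=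
      Finset.sum_lt_sum (fun i _ => Nat.sub_le_sub_left (haa' i) _)
        ⟨j, Finset.mem_univ _, by rw [ha'a, if_pos rfl]; omega⟩
    exact (ih _ (hk ▸ hlt1) hab' (hb'b'.trans hbg) (by omega)
      (fun x y hx hy => hann x y hx (hy.trans hb'b')) rfl).add
      (ih _ (hk ▸ hlt2) ha'b hbg hb (fun x y hx hy => hann x y (haa'.trans hx) hy) rfl)

end Search

/-! ### Stanley decompositions and interval partitions -/

section Partition

variable {n : ℕ} {K M : Type*} [Field K] [AddCommGroup M] [Module K M]
  [Module (MvPolynomial (Fin n) K) M] {𝓜 : (Fin n → ℤ) → Submodule K M} {g : Fin n →₀ ℕ} {s : ℕ}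

omit [Module (MvPolynomial (Fin n) K) M] in
open Classical in
theorem coeff_truncatedHilbertSeries (hdim : ∀ a, Module.rank K (𝓜 a) ≤ 1) (c : Fin n →₀ ℕ) :
    (truncatedHilbertSeries 𝓜 g).coeff c = if c ≤ g ∧ 𝓜 (toInt c) ≠ ⊥ then 1 else 0 := by
  simp only [truncatedHilbertSeries, coeff_sum, coeff_monomial, Finset.sum_ite_eq', Finset.mem_Iic]
  have hfin : Module.Finite K (𝓜 (toInt c)) :=
    Module.rank_lt_aleph0_iff.mp ((hdim _).trans_lt Cardinal.one_lt_aleph0)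
  have h1 : Module.finrank K (𝓜 (toInt c)) ≤ 1 := by
    have := hdim (toInt c)
    rw [← Module.finrank_eq_rank] at this
    exact_mod_cast this
  by_cases hc : c ≤ g <;> by_cases h0 : 𝓜 (toInt c) = ⊥ <;> simp only [hc, h0, true_and, false_and,
    ne_eq, not_true_eq_false, not_false_eq_true, if_true, if_false]
  · simpa using h0
  · have := mt Submodule.finrank_eq_zero.mp h0
    omega

/-- A partition of the degrees `c ≼ g` with `M_c ≠ 0` into intervals `[a,b]` with `ρ(b) ≥ s` that
pass the annihilator test. -/
theorem exists_partition_of_coverable [IsScalarTower K (MvPolynomial (Fin n) K) M]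
    (h𝓜 : IsMultigrading 𝓜) (hdim : ∀ a, Module.rank K (𝓜 a) ≤ 1)
    (hg : IsPositivelyDetermined 𝓜 g) (h : Coverable 𝓜 g s (truncatedHilbertSeries 𝓜 g)) :
    ∃ S : Finset ((Fin n →₀ ℕ) × (Fin n →₀ ℕ)),
      (∀ p ∈ S, p.2 ≤ g ∧ s ≤ rho g p.2 ∧ AnnTest 𝓜 g p.1 p.2) ∧
      ∀ c ≤ g, 𝓜 (toInt c) ≠ ⊥ → ∃! p, p ∈ S ∧ p.1 ≤ c ∧ c ≤ p.2 := by
  classical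
  obtain ⟨𝒮, R, hP, hR, hRs, h𝒮⟩ := h
  have hcoeff : ∀ c, (if c ≤ g ∧ 𝓜 (toInt c) ≠ ⊥ then 1 else 0)
      = ((𝒮.filter fun p => p.1 ≤ c ∧ c ≤ p.2).card : ℤ) + R.coeff c := fun c => by
    rw [← coeff_sum_Q, ← coeff_add, ← hP, coeff_truncatedHilbertSeries hdim]
  -- Leftover exponents become one-point intervals. The coefficient of the series at a degree of `M`
  -- is 1, so exactly one interval contains it.
  refine ⟨𝒮.toFinset ∪ R.support.image fun c => (c, c), fun p hp => ?_, fun c hc hc0 => ?_⟩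
  · rw [Finset.mem_union, Multiset.mem_toFinset, Finset.mem_image] at hp
    rcases hp with hp | ⟨c, hc, rfl⟩
    · obtain ⟨-, h1, h2, h3⟩ := h𝒮 p hp
      exact ⟨h1, h2.ge, h3⟩
    · have hRc := mem_support_iff.mp hc
      have h1 := hcoeff c
      have h2 := hR c
      split_ifs at h1 with h3
      · exact ⟨h3.1, hRs c hc, ((mulNonzero_self_iff c).mpr h3.2).annTest h𝓜 hg le_rfl le_rfl⟩
      · omega
  · have h1 := hcoeff c
    rw [if_pos ⟨hc, hc0⟩] at h1
    have hmem : ∀ p, (p ∈ 𝒮.toFinset ∪ R.support.image fun c => (c, c)) ∧ p.1 ≤ c ∧ c ≤ p.2 ↔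
        (p ∈ 𝒮.filter fun p => p.1 ≤ c ∧ c ≤ p.2) ∨ (p = (c, c) ∧ R.coeff c ≠ 0) := by
      intro p
      rw [Finset.mem_union, Multiset.mem_toFinset, Finset.mem_image, Multiset.mem_filter]
      constructor
      · rintro ⟨h | ⟨d, hd, rfl⟩, h2⟩
        · exact Or.inl ⟨h, h2⟩
        · obtain rfl := le_antisymm h2.1 h2.2
          exact Or.inr ⟨rfl, mem_support_iff.mp hd⟩
      · rintro (⟨h, h2⟩ | ⟨rfl, h⟩)
        · exact ⟨Or.inl h, h2⟩
        · exact ⟨Or.inr ⟨c, mem_support_iff.mpr h, rfl⟩, le_rfl, le_rfl⟩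
    simp only [hmem]
    by_cases hRc : R.coeff c = 0
    · obtain ⟨p, hp⟩ : ∃ p, (𝒮.filter fun p => p.1 ≤ c ∧ c ≤ p.2) = {p} :=
        Multiset.card_eq_one.mp (by omega)
      simp only [hp, hRc]
      simp
    · have h2 := hR c
      have h0 : (𝒮.filter fun p => p.1 ≤ c ∧ c ≤ p.2) = 0 := Multiset.card_eq_zero.mp (by omega)
      simp only [h0]
      simp [hRc]

theorem mem_G {a b c : Fin n →₀ ℕ} :
    c ∈ G g a b ↔ (a ≤ c ∧ c ≤ b) ∧ ∀ j ∈ Z g b, c j = a j := by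
  simp [G]

variable [IsScalarTower K (MvPolynomial (Fin n) K) M]

/-- Each interval `[a,b]` contributes one piece `M_c K[Z_b]` for every `c ∈ 𝒢[a,b]`. For a degree
`x`, the interval is the one through `x ⊓ g`, and `c` must equal `a` on `Z_b` and `x` elsewhere. -/
theorem exists_stanleyDecomposition_of_partition (h𝓜 : IsMultigrading 𝓜)
    (hdim : ∀ a, Module.rank K (𝓜 a) ≤ 1) (hg : IsPositivelyDetermined 𝓜 g)
    {S : Finset ((Fin n →₀ ℕ) × (Fin n →₀ ℕ))}
    (hS : ∀ p ∈ S, p.2 ≤ g ∧ s ≤ rho g p.2 ∧ AnnTest 𝓜 g p.1 p.2)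
    (hcov : ∀ c ≤ g, 𝓜 (toInt c) ≠ ⊥ → ∃! p, p ∈ S ∧ p.1 ≤ c ∧ c ≤ p.2) :
    ∃ (r : ℕ) (m : Fin r → M) (W : Fin r → Finset (Fin n)),
      IsStanleyDecomposition 𝓜 m W ∧ ∀ i, s ≤ (W i).card := by
  classical
  have hμ : ∀ c : Fin n →₀ ℕ, ∃ m ∈ 𝓜 (toInt c), 𝓜 (toInt c) ≠ ⊥ → m ≠ 0 := by
    intro c
    by_cases h : 𝓜 (toInt c) = ⊥
    · exact ⟨0, zero_mem _, fun h' => absurd h h'⟩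
    · obtain ⟨m, hm, hm0⟩ := (Submodule.ne_bot_iff _).mp h
      exact ⟨m, hm, fun _ => hm0⟩
  choose μ hμ hμ0 using hμ
  let I : Finset (((Fin n →₀ ℕ) × (Fin n →₀ ℕ)) × (Fin n →₀ ℕ)) :=
    S.biUnion fun p => (G g p.1 p.2).image fun c => (p, c)
  have hI : ∀ x, x ∈ I ↔ x.1 ∈ S ∧ x.2 ∈ G g x.1.1 x.1.2 := by
    rintro ⟨p, c⟩
    simp only [I, Finset.mem_biUnion, Finset.mem_image, Prod.mk.injEq]
    constructor
    · rintro ⟨q, hq, d, hd, rfl, rfl⟩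
      exact ⟨hq, hd⟩
    · rintro ⟨h1, h2⟩
      exact ⟨p, h1, c, h2, rfl, rfl⟩
  let e := I.equivFin
  have hmem : ∀ i, ((e.symm i).1.1 ∈ S ∧ (e.symm i).1.2 ∈ G g (e.symm i).1.1.1 (e.symm i).1.1.2) :=
    fun i => (hI _).mp (e.symm i).2
  have hann : ∀ i, ∀ f ∈ supported K (Z g (e.symm i).1.1.2 : Set (Fin n)),
      f • μ (e.symm i).1.2 = 0 → f = 0 := by
    intro i f hf hfm
    obtain ⟨h1, h2⟩ := hmem i
    have hne : 𝓜 (toInt (e.symm i).1.2) ≠ ⊥ := by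
      intro hbot
      -- The test applied to `f = 1` shows `M_c ≠ 0`.
      refine one_ne_zero ((hS _ h1).2.2 _ h2 1 (one_mem _) fun m hm => ?_)
      rw [hbot, Submodule.mem_bot] at hm
      rw [hm, smul_zero]
    refine (hS _ h1).2.2 _ h2 f hf fun m hm => ?_
    obtain ⟨k, rfl⟩ := exists_smul_eq_of_rank_le_one (hdim _) (hμ _) (hμ0 _ hne) hm
    rw [smul_smul_comm', hfm, smul_zero]
  refine ⟨I.card, fun i => μ (e.symm i).1.2, fun i => Z g (e.symm i).1.1.2,
    ⟨fun i => ⟨_, hμ _⟩, hann, ?_⟩, fun i => (hS _ (hmem i).1).2.1⟩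
  rw [isInternal_stanleySpace_iff h𝓜 hdim (d := fun i => toInt (e.symm i).1.2)
    (fun i => hμ _) hann]
  intro a ha
  have ha0 : 0 ≤ a := by
    by_contra h
    exact ha (hg.eq_bot a h)
  obtain ⟨x, rfl⟩ := exists_toInt_eq ha0
  obtain ⟨p, ⟨hpS, hp1, hp2⟩, huniq⟩ := hcov (x ⊓ g) inf_le_right (hg.mulNonzero_inf ha)
  have hdeg : ∀ y ∈ I, toInt x ∈ stanleyDegrees (toInt y.2) (Z g y.1.2) ↔
      y.1 = p ∧ ∀ j, y.2 j = if j ∈ Z g p.2 then p.1 j else x j := by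
    rintro ⟨q, c⟩ hy
    obtain ⟨hqS, hc⟩ := (hI _).mp hy
    rw [mem_G] at hc
    simp only [stanleyDegrees, Set.mem_ofPred_eq, toInt_le_toInt] at hqS hc ⊢
    have hqg := (hS q hqS).1
    constructor
    · rintro ⟨hcx, hoff⟩
      have hqp : q = p := by
        refine huniq q ⟨hqS, hc.1.1.trans (le_inf hcx (hc.1.2.trans hqg)), fun j => ?_⟩
        by_cases hj : j ∈ Z g q.2
        · rw [mem_Z] at hj
          rw [hj]; exact inf_le_right
        · have h1 : x j = c j := by simpa [toInt] using hoff j hj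
          exact inf_le_left.trans (h1 ▸ hc.1.2 j)
      subst hqp
      refine ⟨rfl, fun j => ?_⟩
      split_ifs with hj
      · exact hc.2 j hj
      · have h1 : x j = c j := by simpa [toInt] using hoff j hj
        exact h1.symm
    · rintro ⟨rfl, h⟩
      refine ⟨fun j => ?_, fun j hj => ?_⟩
      · rw [h]; split_ifs
        · exact (hp1 j).trans inf_le_left
        · exact le_rfl
      · simp [toInt, h, hj]
  have hpg := (hS p hpS).1
  let c : Fin n →₀ ℕ := Finsupp.equivFunOnFinite.symm fun j => if j ∈ Z g p.2 then p.1 j else x j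
  have hc : ∀ j, c j = if j ∈ Z g p.2 then p.1 j else x j := fun j => rfl
  -- Off `Z_b` one has `(x ⊓ g)_j ≤ b_j < g_j`, so the truncation does not change `x_j`.
  have hx : ∀ j ∉ Z g p.2, (x ⊓ g) j = x j := by
    intro j hj
    have h1 := hp2 j
    have h2 := hpg j
    rw [mem_Z] at hj
    simp only [Finsupp.inf_apply] at h1 ⊢
    omega
  have hcI : (p, c) ∈ I := by
    rw [hI, mem_G]
    refine ⟨hpS, ⟨fun j => ?_, fun j => ?_⟩, fun j hj => by rw [hc, if_pos hj]⟩
    · rw [hc]; split_ifs with hj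
      · exact le_rfl
      · exact hx j hj ▸ hp1 j
    · rw [hc]; split_ifs with hj
      · exact (hp1.trans hp2) j
      · exact hx j hj ▸ hp2 j
  refine ⟨e ⟨(p, c), hcI⟩, ?_, fun i hi => ?_⟩
  · simp only [Equiv.symm_apply_apply]
    exact (hdeg _ hcI).mpr ⟨rfl, hc⟩
  · obtain ⟨h1, h2⟩ := (hdeg _ (e.symm i).2).mp hi
    rw [← Equiv.symm_apply_eq]
    exact Subtype.ext (Prod.ext h1 (Finsupp.ext fun j => by rw [h2, hc]))

/-- A partition of the degrees `c ≼ g` with `M_c ≠ 0` into intervals `[a,b]` with `ρ(b) ≥ s` and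
`X^{b-a} M_a ≠ 0`, in which `b` agrees with `a` or with `g` in each coordinate. -/
def IsIntervalPartition (𝓜 : (Fin n → ℤ) → Submodule K M) (g : Fin n →₀ ℕ) (s : ℕ)
    (S : Finset ((Fin n →₀ ℕ) × (Fin n →₀ ℕ))) : Prop :=
  (∀ p ∈ S, MulNonzero 𝓜 p.1 p.2 ∧ p.2 ≤ g ∧ s ≤ rho g p.2 ∧ ∀ j, p.2 j = g j ∨ p.1 j = p.2 j) ∧
    ∀ c ≤ g, 𝓜 (toInt c) ≠ ⊥ → ∃! p, p ∈ S ∧ p.1 ≤ c ∧ c ≤ p.2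

theorem IsStanleyDecomposition.exists_isIntervalPartition (h𝓜 : IsMultigrading 𝓜)
    (hdim : ∀ a, Module.rank K (𝓜 a) ≤ 1) (hg : IsPositivelyDetermined 𝓜 g)
    {r : ℕ} {m : Fin r → M} {W : Fin r → Finset (Fin n)} (h : IsStanleyDecomposition 𝓜 m W)
    (hs : ∀ i, s ≤ (W i).card) : ∃ S, IsIntervalPartition 𝓜 g s S := by
  classical
  choose d hd using h.homogeneous
  have hm0 : ∀ i, m i ≠ 0 := fun i h0 =>
    one_ne_zero (h.inter_ann i 1 (one_mem _) (by rw [h0, smul_zero]))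
  have hex : ∀ i, ∃ c : Fin n →₀ ℕ, toInt c = d i := fun i => by
    apply exists_toInt_eq
    by_contra hneg
    have := hd i
    rw [hg.eq_bot _ hneg] at this
    exact hm0 i this
  choose e he using hex
  have hcov := (isInternal_stanleySpace_iff h𝓜 hdim hd h.inter_ann).mp h.isInternal
  -- The upper end of the intersection of the cone with the box; cones with `e i ≰ g` miss the box
  -- and are dropped.
  let b : Fin r → Fin n →₀ ℕ := fun i =>
    Finsupp.equivFunOnFinite.symm fun j => if j ∈ W i then g j else e i j
  have hb : ∀ i j, b i j = if j ∈ W i then g j else e i j := fun i j => rfl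
  have heb : ∀ i, e i ≤ g → e i ≤ b i := fun i hi j => by
    rw [hb]; split_ifs
    · exact hi j
    · exact le_rfl
  have hbg : ∀ i, e i ≤ g → b i ≤ g := fun i hi j => by
    rw [hb]; split_ifs
    · exact le_rfl
    · exact hi j
  have hdeg : ∀ i, ∀ c ≤ g, toInt c ∈ stanleyDegrees (d i) (W i) ↔ e i ≤ c ∧ c ≤ b i := by
    intro i c hc
    rw [← he i]
    simp only [stanleyDegrees, Set.mem_ofPred_eq, toInt_le_toInt]
    refine and_congr_right fun hec => ⟨fun h j => ?_, fun h j hj => ?_⟩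
    · rw [hb]; split_ifs with hj
      · exact hc j
      · have : c j = e i j := by simpa [toInt] using h j hj
        exact this.le
    · have := h j
      rw [hb, if_neg hj] at this
      simp [toInt, le_antisymm this (hec j)]
  refine ⟨(Finset.univ.filter fun i => e i ≤ g).image fun i => (e i, b i), ?_, ?_⟩
  · intro p hp
    obtain ⟨i, hi, rfl⟩ := Finset.mem_image.mp hp
    have hig := (Finset.mem_filter.mp hi).2
    refine ⟨⟨heb i hig, m i, he i ▸ hd i, fun h0 => ?_⟩, hbg i hig, (hs i).trans ?_, fun j => ?_⟩
    -- The monomial `X^{b-e}` involves only variables of `W i`, so it cannot annihilate `m i`.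
    · refine one_ne_zero (monomial_eq_zero.mp
        (h.inter_ann i _ (monomial_mem_supported (fun j hj => ?_) 1) h0))
      by_contra hj'
      simp [hb, hj'] at hj
    · refine Finset.card_le_card fun j hj => ?_
      rw [mem_Z, hb, if_pos hj]
    · simp only [hb]; split_ifs
      · exact Or.inl rfl
      · exact Or.inr rfl
  · intro c hc hc0
    obtain ⟨i, hi, huniq⟩ := hcov _ hc0
    simp only at hi huniq
    rw [hdeg i c hc] at hi
    refine ⟨(e i, b i), ⟨Finset.mem_image_of_mem _ (Finset.mem_filter.mpr
      ⟨Finset.mem_univ _, hi.1.trans hc⟩), hi⟩, ?_⟩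
    rintro p ⟨hp, hpc⟩
    obtain ⟨i', -, rfl⟩ := Finset.mem_image.mp hp
    rw [huniq i' ((hdeg i' c hc).mpr hpc)]

theorem IsIntervalPartition.coverable (h𝓜 : IsMultigrading 𝓜)
    (hdim : ∀ a, Module.rank K (𝓜 a) ≤ 1) (hg : IsPositivelyDetermined 𝓜 g)
    {S : Finset ((Fin n →₀ ℕ) × (Fin n →₀ ℕ))} (hS : IsIntervalPartition 𝓜 g s S) :
    Coverable 𝓜 g s (truncatedHilbertSeries 𝓜 g) := by
  classical
  have hsum : truncatedHilbertSeries 𝓜 g = ∑ p ∈ S, Q p.1 p.2 := by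
    ext c
    rw [coeff_truncatedHilbertSeries hdim, coeff_sum]
    simp only [coeff_Q, Finset.mem_Icc]
    rw [Finset.sum_boole]
    split_ifs with hc
    · obtain ⟨p, hp, huniq⟩ := hS.2 c hc.1 hc.2
      have : (S.filter fun p => p.1 ≤ c ∧ c ≤ p.2) = {p} := by
        ext q
        rw [Finset.mem_filter, Finset.mem_singleton]
        exact ⟨huniq q, by rintro rfl; exact hp⟩
      rw [this]; simp
    · rw [Finset.filter_false_of_mem]
      · simp
      · intro p hp hpc
        -- Nonvanishing from end to end forces `M_c ≠ 0` in between, so the intervals contain only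
        -- degrees of `M`.
        obtain ⟨h1, h2, -⟩ := hS.1 p hp
        exact hc ⟨hpc.2.trans h2,
          (mulNonzero_self_iff c).mp (h1.middle h𝓜 hpc.1 le_rfl hpc.2)⟩
  rw [hsum]
  refine Coverable.sum _ _ fun p hp => ?_
  obtain ⟨h1, h2, h3, -⟩ := hS.1 p hp
  exact coverable_Q h1.1 h2 h3 fun a' b' ha hb => h1.annTest h𝓜 hg ha hb

/-- An interval accepted by the procedure may still have `X^{b-a} M_a = 0`. The forward direction
therefore passes through a Stanley decomposition, whose own intervals have nonzero multiplication.
-/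
theorem checkStanleyDepth_eq_true_iff_exists_isIntervalPartition (h𝓜 : IsMultigrading 𝓜)
    (hdim : ∀ a, Module.rank K (𝓜 a) ≤ 1) (hg : IsPositivelyDetermined 𝓜 g)
    (L : Containers g s) :
    checkStanleyDepth 𝓜 g s L (truncatedHilbertSeries 𝓜 g) = true ↔
      ∃ S, IsIntervalPartition 𝓜 g s S := by
  classical
  refine ⟨fun h => ?_, fun ⟨S, hS⟩ => (hS.coverable h𝓜 hdim hg).checkStanleyDepth_eq_true L⟩
  have hcov := coverable_of_checkStanleyDepth_eq_true L _ (fun c hc => ?_) h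
  · obtain ⟨S, hS, hS'⟩ := exists_partition_of_coverable h𝓜 hdim hg hcov
    obtain ⟨r, m, W, hD, hs⟩ := exists_stanleyDecomposition_of_partition h𝓜 hdim hg hS hS'
    exact hD.exists_isIntervalPartition h𝓜 hdim hg hs
  · rw [mem_support_iff, coeff_truncatedHilbertSeries hdim] at hc
    by_contra hcg
    simp [hcg] at hc

theorem checkStanleyDepth_eq_true_iff_exists_isStanleyDecomposition (h𝓜 : IsMultigrading 𝓜)
    (hdim : ∀ a, Module.rank K (𝓜 a) ≤ 1) (hg : IsPositivelyDetermined 𝓜 g)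
    (L : Containers g s) :
    checkStanleyDepth 𝓜 g s L (truncatedHilbertSeries 𝓜 g) = true ↔
      ∃ (r : ℕ) (m : Fin r → M) (W : Fin r → Finset (Fin n)),
        IsStanleyDecomposition 𝓜 m W ∧ ∀ i, s ≤ (W i).card := by
  rw [checkStanleyDepth_eq_true_iff_exists_isIntervalPartition h𝓜 hdim hg]
  constructor
  · rintro ⟨S, hS⟩
    obtain ⟨S', h1, h2⟩ := exists_partition_of_coverable h𝓜 hdim hg (hS.coverable h𝓜 hdim hg)
    exact exists_stanleyDecomposition_of_partition h𝓜 hdim hg h1 h2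
  · rintro ⟨r, m, W, hD, hs⟩
    exact hD.exists_isIntervalPartition h𝓜 hdim hg hs

end Partition

/-! ### The Stanley depth -/

section Sdepth

variable {n : ℕ} {K M : Type*} [Field K] [AddCommGroup M] [Module K M]
  [Module (MvPolynomial (Fin n) K) M] {𝓜 : (Fin n → ℤ) → Submodule K M}

theorem IsMultigrading.shift (h𝓜 : IsMultigrading 𝓜) (u : Fin n → ℤ) :
    IsMultigrading (shift 𝓜 u) where
  isInternal := by
    rw [DirectSum.isInternal_submodule_iff_iSupIndep_and_iSup_eq_top]
    refine ⟨h𝓜.iSupIndep.comp (f := fun a => a + u) (add_left_injective u), ?_⟩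
    rw [← h𝓜.iSup_eq_top]
    exact (Equiv.addRight u).iSup_comp (g := 𝓜)
  gradedSMul := ⟨fun i j f m hf hm => by
    have := h𝓜.gradedSMul.smul_mem hf hm
    rw [vadd_eq_add, ← add_assoc] at this
    exact this⟩

variable [IsScalarTower K (MvPolynomial (Fin n) K) M]

theorem isStanleyDecomposition_shift_iff (u : Fin n → ℤ) {r : ℕ} {m : Fin r → M}
    {W : Fin r → Finset (Fin n)} :
    IsStanleyDecomposition (shift 𝓜 u) m W ↔ IsStanleyDecomposition 𝓜 m W :=
  ⟨fun h => ⟨fun i => (h.homogeneous i).elim fun a ha => ⟨a + u, ha⟩, h.inter_ann, h.isInternal⟩,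
    fun h => ⟨fun i => (h.homogeneous i).elim fun a ha => ⟨a - u, by simpa [shift] using ha⟩,
      h.inter_ann, h.isInternal⟩⟩

theorem sdepth_shift (u : Fin n → ℤ) : sdepth (shift 𝓜 u) = sdepth 𝓜 := by
  simp only [sdepth, isStanleyDecomposition_shift_iff]

/-- The case `s = 0` is separate because a supremum over no decompositions is 0 in `ℕ∞`. -/
theorem le_sdepth_iff {s : ℕ} : (s : ℕ∞) ≤ sdepth 𝓜 ↔ s = 0 ∨
    ∃ (r : ℕ) (m : Fin r → M) (W : Fin r → Finset (Fin n)),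
      IsStanleyDecomposition 𝓜 m W ∧ ∀ i, s ≤ (W i).card := by
  constructor
  · intro h
    by_contra! hno
    obtain ⟨t, rfl⟩ := Nat.exists_eq_succ_of_ne_zero hno.1
    have h1 : sdepth 𝓜 ≤ (t : ℕ∞) := by
      refine iSup₂_le ?_
      rintro s' ⟨r, m, W, hD, hs'⟩
      obtain ⟨i, hi⟩ := hno.2 r m W hD
      exact_mod_cast Nat.lt_succ_iff.mp ((hs' i).trans_lt hi)
    have := h.trans h1
    norm_cast at this
    omega
  · rintro (rfl | h)
    · simp
    · exact le_iSup₂_of_le (f := fun (s : ℕ) (_ : ∃ (r : ℕ) (m : Fin r → M)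
        (W : Fin r → Finset (Fin n)), IsStanleyDecomposition 𝓜 m W ∧ ∀ i, s ≤ (W i).card) =>
        (s : ℕ∞)) s h le_rfl

theorem sdepth_le [Nontrivial M] : sdepth 𝓜 ≤ n := by
  refine iSup₂_le ?_
  rintro s ⟨r, m, W, hD, hs⟩
  rcases r with _ | r
  · have h := hD.isInternal.submodule_iSup_eq_top
    rw [iSup_of_empty] at h
    exact absurd h bot_ne_top
  · exact_mod_cast (hs 0).trans (by simpa using Finset.card_le_univ (W 0))

theorem checkStanleyDepth_eq_true_iff_le_sdepth {g : Fin n →₀ ℕ} {s : ℕ} (h𝓜 : IsMultigrading 𝓜)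
    (hdim : ∀ a, Module.rank K (𝓜 a) ≤ 1) (hg : IsPositivelyDetermined 𝓜 g)
    (L : Containers g s) :
    checkStanleyDepth 𝓜 g s L (truncatedHilbertSeries 𝓜 g) = true ↔ (s : ℕ∞) ≤ sdepth 𝓜 := by
  classical
  rw [le_sdepth_iff, checkStanleyDepth_eq_true_iff_exists_isStanleyDecomposition h𝓜 hdim hg]
  refine ⟨Or.inr, fun h => h.elim ?_ id⟩
  -- No exponent has `ρ < 0`, so the whole series may be taken as the uncovered remainder.
  rintro rfl
  rw [← checkStanleyDepth_eq_true_iff_exists_isStanleyDecomposition h𝓜 hdim hg L]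
  refine Coverable.checkStanleyDepth_eq_true L
    ⟨0, truncatedHilbertSeries 𝓜 g, by simp, fun c => ?_, by simp, by simp⟩
  rw [coeff_truncatedHilbertSeries hdim]
  split_ifs <;> simp

theorem findGreatest_eq_sdepth [Nontrivial M] {p : ℕ → Prop} [DecidablePred p]
    (h : ∀ s, p s ↔ (s : ℕ∞) ≤ sdepth 𝓜) : ((Nat.findGreatest p n : ℕ) : ℕ∞) = sdepth 𝓜 := by
  apply le_antisymm
  · exact (h _).mp (Nat.findGreatest_spec (Nat.zero_le n) ((h 0).mpr (by simp)))
  · obtain ⟨t, ht⟩ := ENat.ne_top_iff_exists.mp (ne_top_of_le_ne_top (by simp) (sdepth_le (𝓜 := 𝓜)))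
    have htn : t ≤ n := by exact_mod_cast ht.trans_le (sdepth_le (𝓜 := 𝓜))
    rw [← ht]
    exact_mod_cast Nat.le_findGreatest htn ((h t).mpr ht.le)

end Sdepth

/-! ### Finitely generated multigraded modules are positively determined up to a shift -/

section Determined

variable {n : ℕ} {K M : Type*} [Field K] [AddCommGroup M] [Module K M]
  [Module (MvPolynomial (Fin n) K) M] {𝓜 : (Fin n → ℤ) → Submodule K M}

/-- The component of degree `a` of a finitely generated graded submodule `N` is spanned by
multiples of elements of `N` whose degrees belong to a fixed finite set. -/
theorem exists_finset_mem_span (h𝓜 : IsMultigrading 𝓜)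
    [IsScalarTower K (MvPolynomial (Fin n) K) M]
    {N : Submodule (MvPolynomial (Fin n) K) M} (hfg : N.FG)
    (hN : N = Submodule.span _ {x | x ∈ N ∧ ∃ a, x ∈ 𝓜 a}) :
    ∃ D : Finset (Fin n → ℤ), ∀ a, ∀ x ∈ N, x ∈ 𝓜 a → x ∈ Submodule.span K
      {z : M | ∃ d ∈ D, ∃ v : Fin n →₀ ℕ, d + toInt v = a ∧ ∃ y ∈ 𝓜 d, y ∈ N ∧
        z = (monomial v 1 : MvPolynomial (Fin n) K) • y} := by
  classical
  rw [hN] at hfg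
  obtain ⟨S, hS, hspan⟩ := Submodule.fg_span_iff_fg_span_finset_subset _ |>.mp hfg
  rw [← hN] at hspan
  choose! δ hδ using fun x (hx : x ∈ {x | x ∈ N ∧ ∃ a, x ∈ 𝓜 a}) => hx.2
  refine ⟨S.image δ, fun a x hxN hxa => ?_⟩
  set T : (Fin n → ℤ) → Submodule K M := fun a => Submodule.span K
    {z : M | ∃ d ∈ S.image δ, ∃ v : Fin n →₀ ℕ, d + toInt v = a ∧ ∃ y ∈ 𝓜 d, y ∈ N ∧
      z = (monomial v 1 : MvPolynomial (Fin n) K) • y} with hT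
  have hT𝓜 : ∀ b, T b ≤ 𝓜 b := by
    intro b
    refine Submodule.span_le.mpr ?_
    rintro _ ⟨d, -, v, rfl, y, hy, -, rfl⟩
    exact h𝓜.monomial_smul_mem hy v 1
  have hxT : x ∈ ⨆ b, T b := by
    rw [hspan] at hxN
    obtain ⟨f, -, rfl⟩ := Submodule.mem_span_finset.mp hxN
    refine Submodule.sum_mem _ fun y hy => ?_
    have hyS := hS hy
    rw [(f y).as_sum, Finset.sum_smul]
    refine Submodule.sum_mem _ fun v _ => ?_
    rw [monomial_smul_eq]
    refine Submodule.smul_mem _ _ (Submodule.mem_iSup_of_mem (δ y + toInt v)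
      (Submodule.subset_span ?_))
    exact ⟨δ y, Finset.mem_image_of_mem _ hy, v, rfl, y, hδ y hyS, hyS.1, rfl⟩
  -- Only the part of degree `a` matters: the contributions of other degrees vanish by independence
  -- of the grading.
  have hle : (⨆ b, T b) ≤ T a ⊔ ⨆ (b) (_ : b ≠ a), 𝓜 b := by
    refine iSup_le fun b => ?_
    by_cases hb : b = a
    · rw [hb]; exact le_sup_left
    · exact (hT𝓜 b).trans ((le_iSup₂_of_le (f := fun b (_ : b ≠ a) => 𝓜 b) b hb le_rfl).trans
        le_sup_right)
  obtain ⟨t, ht, t', ht', rfl⟩ := Submodule.mem_sup.mp (hle hxT)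
  have h0 : t' = 0 := by
    refine Submodule.disjoint_def.mp (h𝓜.iSupIndep a) t' ?_ ht'
    have := Submodule.sub_mem _ hxa (hT𝓜 a ht)
    rwa [add_sub_cancel_left] at this
  rw [h0, add_zero]
  exact ht

theorem IsMultigrading.exists_finsupp (h𝓜 : IsMultigrading 𝓜) (x : M) :
    ∃ f : (Fin n → ℤ) →₀ M, (∀ a, f a ∈ 𝓜 a) ∧ ∑ a ∈ f.support, f a = x := by
  have hx : x ∈ iSup 𝓜 := by rw [h𝓜.iSup_eq_top]; trivial
  exact (Submodule.mem_iSup_iff_exists_finsupp _ _).mp hx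

theorem exists_isPositivelyDetermined_shift (h𝓜 : IsMultigrading 𝓜)
    [IsScalarTower K (MvPolynomial (Fin n) K) M] [Module.Finite (MvPolynomial (Fin n) K) M] :
    ∃ (u : Fin n → ℤ) (g : Fin n →₀ ℕ), IsPositivelyDetermined (shift 𝓜 u) g := by
  classical
  have hX : ∀ (i : Fin n) {a : Fin n → ℤ} {m : M}, m ∈ 𝓜 a →
      (X i : MvPolynomial (Fin n) K) • m ∈ 𝓜 (a + Pi.single i 1) := by
    intro i a m hm
    have h1 := h𝓜.monomial_smul_mem hm (Finsupp.single i 1) 1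
    have h2 : toInt (Finsupp.single i 1) = Pi.single i 1 := by
      ext j
      simp [toInt, Finsupp.single_apply, Pi.single_apply, eq_comm]
    rwa [h2] at h1
  have hXv : ∀ (i : Fin n) (v : Fin n →₀ ℕ), 1 ≤ v i → ∀ m : M,
      (monomial v 1 : MvPolynomial (Fin n) K) • m
        = (X i : MvPolynomial (Fin n) K) • (monomial (v - Finsupp.single i 1) 1 :
          MvPolynomial (Fin n) K) • m := by
    intro i v hv m
    have hle : Finsupp.single i 1 ≤ v := Finsupp.single_le_iff.mpr hv
    conv_lhs => rw [← add_tsub_cancel_of_le hle, monomial_add_smul]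
    rfl
  obtain ⟨D, hD⟩ := exists_finset_mem_span h𝓜 (N := ⊤) Module.Finite.fg_top (by
    symm
    rw [eq_top_iff]
    intro x _
    obtain ⟨f, hf, rfl⟩ := h𝓜.exists_finsupp x
    exact Submodule.sum_mem _ fun a _ => Submodule.subset_span ⟨trivial, a, hf a⟩)
  have hker : ∀ i : Fin n, ∃ D : Finset (Fin n → ℤ), ∀ a, ∀ x ∈ 𝓜 a,
      (X i : MvPolynomial (Fin n) K) • x = 0 → (∀ d ∈ D, d i < a i) → x = 0 := by
    intro i
    let N : Submodule (MvPolynomial (Fin n) K) M :=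
      LinearMap.ker (LinearMap.lsmul (MvPolynomial (Fin n) K) M (X i))
    have hmem : ∀ x, x ∈ N ↔ (X i : MvPolynomial (Fin n) K) • x = 0 := fun x => by simp [N]
    have hNoeth : IsNoetherian (MvPolynomial (Fin n) K) M := inferInstance
    obtain ⟨D, hD⟩ := exists_finset_mem_span h𝓜 (N := N) (hNoeth.noetherian N) (by
      refine le_antisymm (fun x hx => ?_) (Submodule.span_le.mpr fun x hx => hx.1)
      obtain ⟨f, hf, rfl⟩ := h𝓜.exists_finsupp x
      -- The elements `X_i f_a` have distinct degrees, so each is zero: the kernel of `X_i` is a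
      -- graded submodule.
      rw [hmem, Finset.smul_sum] at hx
      have hind : iSupIndep fun a : Fin n → ℤ => 𝓜 (a + Pi.single i 1) :=
        h𝓜.iSupIndep.comp (f := fun a => a + Pi.single i 1) (add_left_injective _)
      have hall := (iSupIndep_iff_finsetSum_eq_zero_imp_eq_zero _).mp hind f.support
        (fun a => (X i : MvPolynomial (Fin n) K) • f a) (fun a _ => hX i (hf a)) hx
      exact Submodule.sum_mem _ fun a ha =>
        Submodule.subset_span ⟨(hmem _).mpr (hall a ha), a, hf a⟩)
    refine ⟨D, fun a x hx hx0 hlt => ?_⟩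
    have h1 := hD a x ((hmem x).mpr hx0) hx
    rw [← Submodule.mem_bot K]
    refine Submodule.span_le.mpr ?_ h1
    rintro _ ⟨d, hd, v, rfl, y, -, hyN, rfl⟩
    -- As `a_i` exceeds `d_i`, the monomial `X^v` contains a factor `X_i`, which kills `y`.
    have h2 := hlt d hd
    simp only [Pi.add_apply, toInt] at h2
    rw [hXv i v (by omega), smul_smul, mul_comm, mul_smul, (hmem y).mp hyN, smul_zero]
    exact zero_mem _
  choose D' hD' using hker
  obtain ⟨u, hu⟩ : ∃ u : Fin n → ℤ, ∀ d ∈ D, u ≤ d := by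
    obtain ⟨w, hw⟩ := (D.image Neg.neg).exists_le
    exact ⟨-w, fun d hd => neg_le.mp (hw _ (Finset.mem_image_of_mem _ hd))⟩
  -- The generators of `M` give surjectivity and those of the kernels injectivity. The `+ 1` below
  -- makes `a_i ≥ g_i` push the unshifted degree `a_i + u_i` strictly beyond all of them.
  obtain ⟨w, hw⟩ := (D ∪ Finset.univ.biUnion D').exists_le
  let g : Fin n →₀ ℕ := Finsupp.equivFunOnFinite.symm fun i => (w i - u i).toNat + 1
  have hg : ∀ i, w i - u i < g i := fun i => by
    have : g i = (w i - u i).toNat + 1 := rfl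
    omega
  refine ⟨u, g, ⟨fun a ha => ?_, fun i a hai => ⟨fun m hm => ?_, fun x hx y hy hxy => ?_,
    fun x hx => ?_⟩⟩⟩
  · rw [eq_bot_iff]
    intro x hx
    refine Submodule.span_le.mpr ?_ (hD _ x trivial hx)
    rintro _ ⟨d, hd, v, hdv, -⟩
    refine absurd (fun j => ?_) ha
    have h1 : u j ≤ d j := hu d hd j
    have h2 := congrFun hdv j
    simp only [Pi.add_apply, toInt] at h2
    change (0 : ℤ) ≤ a j
    omega
  · have := hX i (show m ∈ 𝓜 (a + u) from hm)
    rwa [add_right_comm] at this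
  · have h1 : x - y ∈ 𝓜 (a + u) := Submodule.sub_mem _ hx hy
    refine sub_eq_zero.mp (hD' i _ _ h1 (by rw [smul_sub]; exact sub_eq_zero.mpr hxy)
      fun d hd => ?_)
    have h2 : d i ≤ w i :=
      hw d (Finset.mem_union_right _ (Finset.mem_biUnion.mpr ⟨i, Finset.mem_univ _, hd⟩)) i
    have h3 := hg i
    change d i < a i + u i
    omega
  · suffices x ∈ (𝓜 (a + u)).map
      ((LinearMap.lsmul (MvPolynomial (Fin n) K) M (X i)).restrictScalars K) from this
    refine Submodule.span_le.mpr ?_ (hD _ x trivial hx)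
    rintro _ ⟨d, hd, v, hdv, y, hy, -, rfl⟩
    have h1 : d i ≤ w i := hw d (Finset.mem_union_left _ hd) i
    have h2 := hg i
    have h3 := congrFun hdv i
    simp only [Pi.add_apply, toInt, Pi.single_eq_same] at h3
    have hv : 1 ≤ v i := by omega
    refine ⟨(monomial (v - Finsupp.single i 1) 1 : MvPolynomial (Fin n) K) • y, ?_, ?_⟩
    · have h4 := h𝓜.monomial_smul_mem hy (v - Finsupp.single i 1) 1
      have h5 : d + toInt (v - Finsupp.single i 1) = a + u := by
        ext j
        have h6 := congrFun hdv j
        simp only [Pi.add_apply, toInt, Pi.single_apply, Finsupp.coe_tsub, Pi.sub_apply,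
          Finsupp.single_apply] at h6 ⊢
        by_cases hj : j = i
        · subst hj; simp only [if_true] at h6 ⊢; omega
        · simp only [hj, Ne.symm hj, if_false] at h6 ⊢; omega
      rwa [h5] at h4
    · simp only [LinearMap.coe_restrictScalars, LinearMap.lsmul_apply]
      exact (hXv i v hv y).symm

end Determined

/-! ### Computability of the Stanley depth -/

section Computable

/-! ### Primitive recursive operations on lists -/

section Primrec

variable {α γ : Type*} [Primcodable α] [Primcodable γ]

theorem primrecPred_forall_mem {f : γ → List α} {R : α → γ → Prop} (hf : Primrec f)
    (hR : PrimrecRel R) : PrimrecPred fun x => ∀ a ∈ f x, R a x :=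
  hR.forall_mem_list.comp hf .id

theorem primrecPred_exists_mem {f : γ → List α} {R : α → γ → Prop} (hf : Primrec f)
    (hR : PrimrecRel R) : PrimrecPred fun x => ∃ a ∈ f x, R a x :=
  hR.exists_mem_list.comp hf .id

theorem primrecPred_forall_lt {f : γ → ℕ} {R : ℕ → γ → Prop} (hf : Primrec f)
    (hR : PrimrecRel R) : PrimrecPred fun x => ∀ a < f x, R a x :=
  (primrecPred_forall_mem (Primrec.list_range.comp hf) hR).of_eq (by simp)

theorem primrec_sublists' : Primrec (List.sublists' : List α → List (List α)) := by
  have h : Primrec fun l : List α =>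
      l.foldr (fun a acc => acc ++ acc.map (List.cons a)) [[]] := by
    refine Primrec.list_foldr
      (h := fun (_ : List α) (p : α × List (List α)) => p.2 ++ p.2.map (List.cons p.1))
      .id (.const [[]]) ?_
    refine Primrec.list_append.comp (Primrec.snd.comp Primrec.snd) ?_
    refine Primrec.list_map (Primrec.snd.comp Primrec.snd) ?_
    exact Primrec.list_cons.comp (Primrec.fst.comp (Primrec.snd.comp Primrec.fst)) Primrec.snd
  refine h.of_eq fun l => ?_
  induction l with
  | nil => rfl
  | cons a l ih => rw [List.foldr_cons, ih, List.sublists'_cons]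

/-- The componentwise order on the first `k` entries of two lists. -/
def ListLE (k : ℕ) (a b : List ℕ) : Prop := ∀ j < k, a.getD j 0 ≤ b.getD j 0

/-- The number of positions below `k` in which two lists agree. -/
def agreeCount (k : ℕ) (a b : List ℕ) : ℕ :=
  ((List.range k).filter fun j => a.getD j 0 = b.getD j 0).length

variable {k : γ → ℕ} {a b : γ → List ℕ}

theorem primrec_getD (ha : Primrec a) : Primrec₂ fun (j : ℕ) (x : γ) => (a x).getD j 0 :=
  (Primrec.list_getD 0).comp (ha.comp Primrec.snd) Primrec.fst

theorem primrecPred_listLE (hk : Primrec k) (ha : Primrec a) (hb : Primrec b) :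
    PrimrecPred fun x => ListLE (k x) (a x) (b x) :=
  primrecPred_forall_lt hk (Primrec.nat_le.comp (primrec_getD ha) (primrec_getD hb))

theorem primrec_agreeCount (hk : Primrec k) (ha : Primrec a) (hb : Primrec b) :
    Primrec fun x => agreeCount (k x) (a x) (b x) := by
  have hR : PrimrecRel fun (j : ℕ) (x : γ) => (a x).getD j 0 = (b x).getD j 0 :=
    Primrec.eq.comp (primrec_getD ha) (primrec_getD hb)
  exact Primrec.list_length.comp (hR.listFilter.comp (Primrec.list_range.comp hk) .id)

end Primrec

/-- The list `D` of pairs describes, by means of the multiplication table `T`, an interval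
partition in which all upper ends have `ρ ≥ s`. -/
def IsCertificate (g : List ℕ) (T : List (List ℕ × List ℕ)) (s : ℕ)
    (D : List (List ℕ × List ℕ)) : Prop :=
  (∀ p ∈ D, s ≤ agreeCount g.length p.2 g ∧
    ∀ j < g.length, p.2.getD j 0 = g.getD j 0 ∨ p.1.getD j 0 = p.2.getD j 0) ∧
  ∀ q ∈ T, (∃ p ∈ D, ListLE g.length p.1 q.1 ∧ ListLE g.length q.1 p.2) ∧
    ∀ p ∈ D, ∀ p' ∈ D, ¬ ((ListLE g.length p.1 q.1 ∧ ListLE g.length q.1 p.2) ∧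
      (ListLE g.length p'.1 q.1 ∧ ListLE g.length q.1 p'.2)) ∨ p = p'

theorem primrecPred_isCertificate {γ : Type*} [Primcodable γ] {g : γ → List ℕ}
    {T D : γ → List (List ℕ × List ℕ)} {s : γ → ℕ} (hg : Primrec g) (hT : Primrec T)
    (hs : Primrec s) (hD : Primrec D) :
    PrimrecPred fun x => IsCertificate (g x) (T x) (s x) (D x) := by
  have hlen := Primrec.list_length.comp hg
  refine PrimrecPred.and (primrecPred_forall_mem hD (PrimrecPred.and ?_ ?_))
    (primrecPred_forall_mem hT (PrimrecPred.and ?_ ?_))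
  · exact Primrec.nat_le.comp (hs.comp Primrec.snd) (primrec_agreeCount (hlen.comp Primrec.snd)
      (Primrec.snd.comp Primrec.fst) (hg.comp Primrec.snd))
  · refine primrecPred_forall_lt (hlen.comp Primrec.snd) (PrimrecPred.or ?_ ?_)
    · exact Primrec.eq.comp (primrec_getD (Primrec.snd.comp Primrec.fst))
        (primrec_getD (hg.comp Primrec.snd))
    · exact Primrec.eq.comp (primrec_getD (Primrec.fst.comp Primrec.fst))
        (primrec_getD (Primrec.snd.comp Primrec.fst))
  · refine primrecPred_exists_mem (hD.comp Primrec.snd) (PrimrecPred.and ?_ ?_)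
    · exact primrecPred_listLE (hlen.comp (Primrec.snd.comp Primrec.snd))
        (Primrec.fst.comp Primrec.fst) (Primrec.fst.comp (Primrec.fst.comp Primrec.snd))
    · exact primrecPred_listLE (hlen.comp (Primrec.snd.comp Primrec.snd))
        (Primrec.fst.comp (Primrec.fst.comp Primrec.snd)) (Primrec.snd.comp Primrec.fst)
  · refine primrecPred_forall_mem (hD.comp Primrec.snd)
      (primrecPred_forall_mem (hD.comp (Primrec.snd.comp Primrec.snd))
        (PrimrecPred.or (PrimrecPred.not (PrimrecPred.and (PrimrecPred.and ?_ ?_)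
          (PrimrecPred.and ?_ ?_))) ?_))
    · exact primrecPred_listLE (hlen.comp (Primrec.snd.comp (Primrec.snd.comp Primrec.snd)))
        (Primrec.fst.comp (Primrec.fst.comp Primrec.snd))
        (Primrec.fst.comp (Primrec.fst.comp (Primrec.snd.comp Primrec.snd)))
    · exact primrecPred_listLE (hlen.comp (Primrec.snd.comp (Primrec.snd.comp Primrec.snd)))
        (Primrec.fst.comp (Primrec.fst.comp (Primrec.snd.comp Primrec.snd)))
        (Primrec.snd.comp (Primrec.fst.comp Primrec.snd))
    · exact primrecPred_listLE (hlen.comp (Primrec.snd.comp (Primrec.snd.comp Primrec.snd)))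
        (Primrec.fst.comp Primrec.fst)
        (Primrec.fst.comp (Primrec.fst.comp (Primrec.snd.comp Primrec.snd)))
    · exact primrecPred_listLE (hlen.comp (Primrec.snd.comp (Primrec.snd.comp Primrec.snd)))
        (Primrec.fst.comp (Primrec.fst.comp (Primrec.snd.comp Primrec.snd)))
        (Primrec.snd.comp Primrec.fst)
    · exact Primrec.eq.comp (Primrec.fst.comp Primrec.snd) Primrec.fst

open Classical in
/-- The Stanley depth as a function of `g` and of the multiplication table, found by a search
through all sublists of the table. -/
noncomputable def depthOfTable (x : List ℕ × List (List ℕ × List ℕ)) : ℕ :=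
  Nat.findGreatest (fun s => ∃ D ∈ x.2.sublists', IsCertificate x.1 x.2 s D) x.1.length

theorem computable_depthOfTable : Computable depthOfTable := by
  classical
  refine Primrec.to_comp (Primrec.nat_findGreatest (Primrec.list_length.comp Primrec.fst) ?_)
  refine primrecPred_exists_mem (primrec_sublists'.comp (Primrec.snd.comp Primrec.fst)) ?_
  exact primrecPred_isCertificate (Primrec.fst.comp (Primrec.fst.comp Primrec.snd))
    (Primrec.snd.comp (Primrec.fst.comp Primrec.snd)) (Primrec.snd.comp Primrec.snd) Primrec.fst

/-! ### Exponent vectors as lists, and certificates as interval partitions -/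

variable {n : ℕ}

theorem getD_ofFn (a : Fin n →₀ ℕ) (j : Fin n) : (List.ofFn a).getD j 0 = a j := by
  rw [List.getD_eq_getElem _ _ (by simp)]
  simp

theorem ofFn_injective : Function.Injective fun a : Fin n →₀ ℕ => List.ofFn a :=
  List.ofFn_injective.comp DFunLike.coe_injective

/-- Positions below `n` lie inside both lists, so the default value 0 of `getD` is never read. -/
theorem listLE_ofFn {a b : Fin n →₀ ℕ} : ListLE n (List.ofFn a) (List.ofFn b) ↔ a ≤ b := by
  refine ⟨fun h j => ?_, fun h j hj => ?_⟩
  · simpa only [getD_ofFn] using h j j.2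
  · rw [getD_ofFn a ⟨j, hj⟩, getD_ofFn b ⟨j, hj⟩]
    exact h _

theorem agreeCount_ofFn (a g : Fin n →₀ ℕ) :
    agreeCount n (List.ofFn a) (List.ofFn g) = rho g a := by
  have h : agreeCount n (List.ofFn a) (List.ofFn g) = ((Finset.range n).filter fun j =>
      (List.ofFn a).getD j 0 = (List.ofFn g).getD j 0).card := rfl
  rw [h, rho, Z, Finset.card_filter, Finset.card_filter, Finset.sum_range]
  simp only [getD_ofFn]

variable {K M : Type*} [Field K] [AddCommGroup M] [Module K M]
  [Module (MvPolynomial (Fin n) K) M] {𝓜 : (Fin n → ℤ) → Submodule K M} {g : Fin n →₀ ℕ}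
  {T : List (List ℕ × List ℕ)}

theorem IsMultiplicationTable.mem_iff (hT : IsMultiplicationTable 𝓜 g T) (a b : Fin n →₀ ℕ) :
    (List.ofFn a, List.ofFn b) ∈ T ↔ MulNonzero 𝓜 a b ∧ b ≤ g := by
  rw [hT]
  constructor
  · rintro ⟨a', b', hab, hb, hm, heq⟩
    obtain ⟨h1, h2⟩ := Prod.mk.inj heq
    obtain rfl := ofFn_injective h1
    obtain rfl := ofFn_injective h2
    exact ⟨⟨hab, hm⟩, hb⟩
  · rintro ⟨⟨hab, hm⟩, hb⟩
    exact ⟨a, b, hab, hb, hm, rfl⟩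

/-- Intervals of a partition are entries of `T`, so sublists of `T` exhaust the candidates. The
first components of the entries of `T` are exactly the degrees of `M` in the box, so the covering
condition can be tested on `T`. -/
theorem IsMultiplicationTable.exists_isCertificate_iff (hT : IsMultiplicationTable 𝓜 g T)
    (h𝓜 : IsMultigrading 𝓜) (s : ℕ) :
    (∃ D ∈ T.sublists', IsCertificate (List.ofFn g) T s D) ↔
      ∃ S, IsIntervalPartition 𝓜 g s S := by
  classical
  have hform : ∀ q ∈ T, ∃ a b : Fin n →₀ ℕ, q = (List.ofFn a, List.ofFn b) := fun q hq => by
    obtain ⟨a, b, -, -, -, h⟩ := (hT q).mp hq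
    exact ⟨a, b, h⟩
  constructor
  · rintro ⟨D, hD, h1, h2⟩
    have hDT := (List.mem_sublists'.mp hD).subset
    rw [List.length_ofFn] at h1 h2
    let S := ((Finset.Iic g) ×ˢ (Finset.Iic g)).filter fun p => (List.ofFn p.1, List.ofFn p.2) ∈ D
    have hS : ∀ p, p ∈ S ↔ (List.ofFn p.1, List.ofFn p.2) ∈ D := by
      intro p
      simp only [S, Finset.mem_filter, Finset.mem_product, Finset.mem_Iic]
      refine ⟨And.right, fun h => ⟨?_, h⟩⟩
      obtain ⟨h3, h4⟩ := (hT.mem_iff _ _).mp (hDT h)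
      exact ⟨h3.1.trans h4, h4⟩
    refine ⟨S, fun p hp => ?_, fun c hc hc0 => ?_⟩
    · rw [hS] at hp
      obtain ⟨h3, h4⟩ := (hT.mem_iff _ _).mp (hDT hp)
      obtain ⟨h5, h6⟩ := h1 _ hp
      rw [agreeCount_ofFn] at h5
      exact ⟨h3, h4, h5, fun j => by simpa only [getD_ofFn] using h6 j j.2⟩
    · obtain ⟨⟨p, hp, hpc⟩, huniq⟩ :=
        h2 _ ((hT.mem_iff c c).mpr ⟨(mulNonzero_self_iff c).mpr hc0, hc⟩)
      obtain ⟨a, b, rfl⟩ := hform p (hDT hp)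
      simp only [listLE_ofFn] at hpc
      refine ⟨(a, b), ⟨(hS _).mpr hp, hpc⟩, ?_⟩
      rintro ⟨a', b'⟩ ⟨hp', hpc'⟩
      have h3 := huniq _ ((hS _).mp hp') _ hp
      simp only [listLE_ofFn] at h3
      obtain ⟨h4, h5⟩ := Prod.mk.inj (h3.resolve_left fun h => h ⟨hpc', hpc⟩)
      rw [ofFn_injective h4, ofFn_injective h5]
  · rintro ⟨S, hS1, hS2⟩
    have hD : ∀ q, q ∈ T.filter (fun q => ∃ p ∈ S, q = (List.ofFn p.1, List.ofFn p.2)) ↔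
        ∃ p ∈ S, q = (List.ofFn p.1, List.ofFn p.2) := by
      intro q
      rw [List.mem_filter, decide_eq_true_eq]
      refine ⟨And.right, fun h => ⟨?_, h⟩⟩
      obtain ⟨p, hp, rfl⟩ := h
      exact (hT.mem_iff _ _).mpr ⟨(hS1 p hp).1, (hS1 p hp).2.1⟩
    refine ⟨T.filter (fun q => ∃ p ∈ S, q = (List.ofFn p.1, List.ofFn p.2)),
      List.mem_sublists'.mpr List.filter_sublist, ?_, ?_⟩
    · intro q hq
      obtain ⟨p, hp, rfl⟩ := (hD q).mp hq
      obtain ⟨-, -, h1, h2⟩ := hS1 p hp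
      rw [List.length_ofFn, agreeCount_ofFn]
      refine ⟨h1, fun j hj => ?_⟩
      have := h2 ⟨j, hj⟩
      rwa [← getD_ofFn, ← getD_ofFn, ← getD_ofFn] at this
    · intro q hq
      obtain ⟨c, d, rfl⟩ := hform q hq
      obtain ⟨hcd, hdg⟩ := (hT.mem_iff c d).mp hq
      obtain ⟨p, ⟨hp, hpc⟩, huniq⟩ := hS2 c (hcd.1.trans hdg)
        ((mulNonzero_self_iff c).mp (hcd.middle h𝓜 le_rfl le_rfl hcd.1))
      rw [List.length_ofFn]
      refine ⟨⟨_, (hD _).mpr ⟨p, hp, rfl⟩, ?_⟩, ?_⟩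
      · simpa only [listLE_ofFn] using hpc
      · intro q1 hq1 q2 hq2
        obtain ⟨p1, hp1, rfl⟩ := (hD _).mp hq1
        obtain ⟨p2, hp2, rfl⟩ := (hD _).mp hq2
        simp only [listLE_ofFn]
        by_contra! hne
        exact hne.2 (by rw [huniq p1 ⟨hp1, hne.1.1⟩, huniq p2 ⟨hp2, hne.1.2⟩])

end Computable

end StanleyDepth

theorem mainTheorem4 :
    ∃ F : List ℕ × List (List ℕ × List ℕ) → ℕ, Computable F ∧
      ∀ (n : ℕ) (K M : Type*) [Field K] [AddCommGroup M] [Module K M]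
        [Module (MvPolynomial (Fin n) K) M] [IsScalarTower K (MvPolynomial (Fin n) K) M]
        [Module.Finite (MvPolynomial (Fin n) K) M]
        (𝓜 : (Fin n → ℤ) → Submodule K M),
        StanleyDepth.IsMultigrading 𝓜 →
        (∀ a, Module.rank K (𝓜 a) ≤ 1) →
        -- after a shift of degrees, `M` is positively `g`-determined for some `g`
        (∃ (u : Fin n → ℤ) (g : Fin n →₀ ℕ),
          StanleyDepth.IsPositivelyDetermined (StanleyDepth.shift 𝓜 u) g) ∧
        -- for all such `u` and `g`, and whatever the order in which the lists are searched:
        ∀ (u : Fin n → ℤ) (g : Fin n →₀ ℕ),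
          StanleyDepth.IsPositivelyDetermined (StanleyDepth.shift 𝓜 u) g →
          ∀ L : ∀ s : ℕ, StanleyDepth.Containers g s,
            -- the procedure returns `true` exactly when `sdepth M ≥ s`
            (∀ s : ℕ,
              StanleyDepth.checkStanleyDepth (StanleyDepth.shift 𝓜 u) g s (L s)
                (StanleyDepth.truncatedHilbertSeries (StanleyDepth.shift 𝓜 u) g) = true ↔
              (s : ℕ∞) ≤ StanleyDepth.sdepth 𝓜) ∧
            -- the largest accepted `s ≤ n` is the Stanley depth
            (Nontrivial M →
              ((Nat.findGreatest (fun s : ℕ =>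
                StanleyDepth.checkStanleyDepth (StanleyDepth.shift 𝓜 u) g s (L s)
                  (StanleyDepth.truncatedHilbertSeries (StanleyDepth.shift 𝓜 u) g) = true) n : ℕ) :
                ℕ∞) = StanleyDepth.sdepth 𝓜) ∧
            -- and it is a computable function of finite data describing `M`
            (∀ T : List (List ℕ × List ℕ),
              StanleyDepth.IsMultiplicationTable (StanleyDepth.shift 𝓜 u) g T →
              F (List.ofFn g, T) =
                Nat.findGreatest (fun s : ℕ =>
                  StanleyDepth.checkStanleyDepth (StanleyDepth.shift 𝓜 u) g s (L s)
                    (StanleyDepth.truncatedHilbertSeries (StanleyDepth.shift 𝓜 u) g) = true) n) := by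
  classical
  refine ⟨StanleyDepth.depthOfTable, StanleyDepth.computable_depthOfTable, ?_⟩
  intro n K M _ _ _ _ _ _ 𝓜 h𝓜 hdim
  refine ⟨StanleyDepth.exists_isPositivelyDetermined_shift h𝓜, fun u g hg L => ?_⟩
  have h𝓝 := h𝓜.shift u
  have hdim' : ∀ a, Module.rank K (StanleyDepth.shift 𝓜 u a) ≤ 1 := fun a => hdim (a + u)
  have key := fun s =>
    StanleyDepth.checkStanleyDepth_eq_true_iff_le_sdepth (s := s) h𝓝 hdim' hg (L s)
  simp only [StanleyDepth.sdepth_shift] at key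
  refine ⟨key, fun _ => StanleyDepth.findGreatest_eq_sdepth key, fun T hT => ?_⟩
  rw [StanleyDepth.depthOfTable, List.length_ofFn]
  congr 1
  funext s
  -- Both predicates say that an interval partition exists, and both searches are bounded by `n`.
  rw [hT.exists_isCertificate_iff h𝓝, eq_iff_iff]
  exact (StanleyDepth.checkStanleyDepth_eq_true_iff_exists_isIntervalPartition
    h𝓝 hdim' hg (L s)).symm
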